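/- Let $H\in(\tfrac12,1)$ and $\theta>0$. Let $B=(B_t)_{t\ge 0}$ be a fractional Brownian motion with Hurst parameter $H$ on a probability space, i.e. a centered Gaussian process with $B_0=0$, almost surely continuous paths, and covariance $$E(B_tB_s)=\tfrac12\left(t^{2H}+s^{2H}-|t-s|^{2H}\right),\qquad s,t\ge 0.$$ Let $X=(X_t)_{t\ge0}$ be the fractional Ornstein–Uhlenbeck process driven by $B$, i.e. the process with almost surely continuous paths such that, almost surely, $X_0=0$ and $X_t=\theta\int_0^tX_s\,ds+B_t$ for all $t\ge 0$. For $t>0$ let $$\widehat\theta_t=\frac{\int_0^tX_s\,dX_s}{\int_0^tX_s^2\,ds}$$ be the least squares estimator of $\theta$, where $\int_0^tX_s\,dX_s$ is a pathwise Young integral: the limit of Riemann–Stieltjes sums as the mesh tends to $0$, the paths being Hölder continuous on $[0,t]$ of orders $\alpha,\beta\in(0,1)$ with $\alpha+\beta>1$. Then, almost surely, for every $t>0$ the Young integral $\int_0^tX_s\,dX_s$ exists and $\int_0^tX_s^2\,ds>0$, so that $\widehat\theta_t$ is well defined; and, as $t\to\infty$, $$e^{\theta t}\left(\widehat\theta_t-\theta\right)\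 \longrightarrow\ 2\theta\,\mathcal C(1)\quad\text{in law},$$ where $\mathcal C(1)$ is the standard Cauchy distribution, with density $\frac{1}{\pi(1+x^2)}$, $x\in\mathbb R$. -/

import Mathlib

open MeasureTheory ProbabilityTheory Filter Topology
open scoped NNReal

/-- The real path `s ↦ X_s(ω)` of a process indexed by `[0, ∞)`. It is only ever used on
intervals `[0, t]` with `0 ≤ t`, where `s.toNNReal` is just `s`. -/
def samplePath {Ω : Type*} (X : ℝ≥0 → Ω → ℝ) (ω : Ω) : ℝ → ℝ :=
  fun s => X s.toNNReal ω

/-- `a = u 0 ≤ u 1 ≤ … ≤ u n = b` is a partition of `[a, b]`, with tags `c i ∈ [u i, u (i+1)]`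
for `i < n`. -/
structure IsTaggedPartition (a b : ℝ) (n : ℕ) (u c : ℕ → ℝ) : Prop where
  left : u 0 = a
  right : u n = b
  step : ∀ i < n, u i ≤ u (i + 1)
  tag : ∀ i < n, c i ∈ Set.Icc (u i) (u (i + 1))

/-- `I` is the limit of the Riemann–Stieltjes sums `∑ f(c_i) (g(u_{i+1}) - g(u_i))` over tagged
partitions of `[a, b]` as the mesh tends to zero. -/
def IsRiemannStieltjesIntegral (f g : ℝ → ℝ) (a b I : ℝ) : Prop :=
  ∀ ε > 0, ∃ δ > 0, ∀ (n : ℕ) (u c : ℕ → ℝ), IsTaggedPartition a b n u c →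
    (∀ i < n, u (i + 1) - u i < δ) →
    |∑ i ∈ Finset.range n, f (c i) * (g (u (i + 1)) - g (u i)) - I| < ε

/-- `f` and `g` are Hölder continuous on `[a, b]`, of orders `α, β ∈ (0, 1)` with `α + β > 1`, and
`I` is the Riemann–Stieltjes (that is, Young) integral `∫_a^b f dg`. -/
def IsYoungIntegral (f g : ℝ → ℝ) (a b I : ℝ) : Prop :=
  (∃ α β C D : ℝ≥0, 0 < α ∧ α < 1 ∧ 0 < β ∧ β < 1 ∧ 1 < α + β ∧
    HolderOnWith C α f (Set.Icc a b) ∧ HolderOnWith D β g (Set.Icc a b)) ∧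
  IsRiemannStieltjesIntegral f g a b I

/-- There is at most one Riemann–Stieltjes integral over `[a, b]`. -/
theorem IsRiemannStieltjesIntegral.unique {f g : ℝ → ℝ} {a b I J : ℝ} (hab : a ≤ b)
    (hI : IsRiemannStieltjesIntegral f g a b I) (hJ : IsRiemannStieltjesIntegral f g a b J) :
    I = J := by
  by_contra hne
  have hpos : 0 < |I - J| / 2 := by
    have := abs_pos.mpr (sub_ne_zero.mpr hne)
    positivity
  obtain ⟨δ₁, hδ₁, h₁⟩ := hI _ hpos
  obtain ⟨δ₂, hδ₂, h₂⟩ := hJ _ hpos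
  have hδ : 0 < min δ₁ δ₂ := lt_min hδ₁ hδ₂
  obtain ⟨m, hm⟩ := exists_nat_gt ((b - a) / min δ₁ δ₂)
  have hm0 : (0 : ℝ) < m := lt_of_le_of_lt (div_nonneg (sub_nonneg.mpr hab) hδ.le) hm
  have hmesh : (b - a) / m < min δ₁ δ₂ := by
    rw [div_lt_iff₀ hδ] at hm
    rw [div_lt_iff₀ hm0]
    linarith
  have hstep : ∀ i : ℕ, (a + (b - a) / m * ((i + 1 : ℕ) : ℝ)) - (a + (b - a) / m * (i : ℝ))
      = (b - a) / m := by
    intro i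
    push_cast
    ring
  have hnn : 0 ≤ (b - a) / m := div_nonneg (sub_nonneg.mpr hab) hm0.le
  have hP : IsTaggedPartition a b m (fun i => a + (b - a) / m * (i : ℝ))
      (fun i => a + (b - a) / m * (i : ℝ)) := by
    refine ⟨by simp, ?_, fun i _ => ?_, fun i _ => ⟨le_rfl, ?_⟩⟩
    · field_simp
      ring
    · linarith [hstep i]
    · linarith [hstep i]
  have e₁ := h₁ m _ _ hP (fun i _ => by
    rw [hstep i]
    exact lt_of_lt_of_le hmesh (min_le_left _ _))
  have e₂ := h₂ m _ _ hP (fun i _ => by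
    rw [hstep i]
    exact lt_of_lt_of_le hmesh (min_le_right _ _))
  rw [abs_sub_comm] at e₁
  have := abs_sub_le I (∑ i ∈ Finset.range m, f (a + (b - a) / m * (i : ℝ)) *
    (g (a + (b - a) / m * ((i + 1 : ℕ) : ℝ)) - g (a + (b - a) / m * (i : ℝ)))) J
  linarith

open Classical in
/-- The Young integral `∫_a^b f dg` (with the value `0` if it does not exist). -/
noncomputable def youngIntegral (f g : ℝ → ℝ) (a b : ℝ) : ℝ :=
  if h : ∃ I, IsYoungIntegral f g a b I then h.choose else 0

/-- `B` is a fractional Brownian motion with Hurst parameter `H`: a centered Gaussian process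
starting from zero, with covariance `(t^{2H} + s^{2H} - |t - s|^{2H}) / 2`, in its version with
(almost surely) continuous paths. -/
structure IsFractionalBrownianMotion {Ω : Type*} [MeasurableSpace Ω] (H : ℝ) (B : ℝ≥0 → Ω → ℝ)
    (P : Measure Ω) : Prop where
  gaussian : IsGaussianProcess B P
  start : ∀ᵐ ω ∂P, B 0 ω = 0
  centered : ∀ t, ∫ ω, B t ω ∂P = 0
  covariance : ∀ t s, ∫ ω, B t ω * B s ω ∂P =
    ((t : ℝ) ^ (2 * H) + (s : ℝ) ^ (2 * H) - |(t : ℝ) - (s : ℝ)| ^ (2 * H)) / 2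
  continuous_paths : ∀ᵐ ω ∂P, Continuous fun t => B t ω

/-- `X` solves `X_0 = 0`, `dX_t = θ X_t dt + dB_t`: almost surely, the path of `X` is continuous,
starts from zero, and `X_t = θ ∫_0^t X_s ds + B_t` for all `t ≥ 0`. -/
def IsOrnsteinUhlenbeck {Ω : Type*} [MeasurableSpace Ω] (θ : ℝ) (B X : ℝ≥0 → Ω → ℝ)
    (P : Measure Ω) : Prop :=
  ∀ᵐ ω ∂P, (Continuous fun t => X t ω) ∧ X 0 ω = 0 ∧
    ∀ t : ℝ≥0, X t ω = θ * (∫ s in (0 : ℝ)..t, samplePath X ω s) + B t ω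

/-- The least squares estimator `∫_0^t X_s dX_s / ∫_0^t X_s² ds`, with a Young integral in the
numerator. -/
noncomputable def leastSquaresEstimator {Ω : Type*} (X : ℝ≥0 → Ω → ℝ) (t : ℝ≥0) (ω : Ω) : ℝ :=
  youngIntegral (samplePath X ω) (samplePath X ω) 0 t /
    ∫ s in (0 : ℝ)..t, samplePath X ω s ^ 2

/-! Write `S = ∫_0^t X²` and `N = X_t²/2 - θ S`. The paths of `B`, hence of `X`, are Hölder of some
order above `1/2`, so the chain rule holds for the Young integral: `∫_0^t X dX = X_t²/2`, and the
estimation error is `N / S`.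

Set `F_t = e^{-θt} X_t`, and let `A` be the stable companion `dA = -θ A dt + dB`, `A_0 = 0`, built
from the same noise. An energy identity, proved path by path, gives `N = X_t A_t - (A_t²/2 + θ ∫_0^t
A²)`. With `R_t = e^{-θt} (A_t²/2 + θ ∫_0^t A²)` this reads `e^{-θt} N = F A - R`, while `e^{-2θt} θ
S = F²/2 - e^{-θt} (F A - R)`. Hence the normalized error is `θ (F A - R) / (F²/2 - e^{-θt} (F A -
R))`, with no stochastic integral left (`ae_estimationError_eq`).

Both `F` and `A` are averages over an exponential time `τ` of rate `θ`: `F_t` averages `B_{τ∧t}`,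
and `A_t` averages `B_t - B_{t-τ∧t}`. Any combination `a F_t + b A_t` is therefore an integral of a
Gaussian process, so a centered Gaussian variable whose variance is a double integral of
covariances. Stationary increments give both averages the same limiting variance `v > 0`. The cross
terms are second differences of `x^{2H}`, which vanish at infinity because `2H < 2`. By dominated
convergence the variance tends to `(a² + b²) v`, so `(F, A)` converges in law to two independent
`N(0, v)` variables (`tendstoInDistribution_averages`).

The second moments of `A` are bounded in time, so `R → 0` in `L¹`. Slutsky's lemma and the
continuous mapping theorem give the limit `2θ A/F`, and the ratio of two independent centered
Gaussians of equal variance is standard Cauchy (`map_div_prod_gaussianReal`). -/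

/-! ### Chain rule for Young integrals. -/

/-- The Young integral of a Hölder continuous function of order larger than `1 / 2` against
itself is given by the chain rule. -/
theorem isRiemannStieltjesIntegral_self {f : ℝ → ℝ} {a b : ℝ} {C α : ℝ≥0}
    (hα : (1 / 2 : ℝ) < α) (hf : HolderOnWith C α f (Set.Icc a b)) :
    IsRiemannStieltjesIntegral f f a b ((f b ^ 2 - f a ^ 2) / 2) := by
  have hdist : ∀ x ∈ Set.Icc a b, ∀ y ∈ Set.Icc a b, |f x - f y| ≤ C * |x - y| ^ (α : ℝ) := by
    intro x hx y hy
    have := hf.dist_le hx hy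
    simpa [Real.dist_eq] using this
  intro ε hε
  have hγ : 0 < 2 * (α : ℝ) - 1 := by linarith
  -- Each interval of length `Δ` contributes an error at most `C² Δ^{2α} ≤ C² δ^{2α-1} Δ`; the sum
  -- over the partition is the quantity here, small because `2α > 1`.
  have hlim : Tendsto (fun δ : ℝ => (C : ℝ) ^ 2 * δ ^ (2 * (α : ℝ) - 1) * (b - a)) (𝓝 0) (𝓝 0) := by
    have h1 : Tendsto (fun δ : ℝ => δ ^ (2 * (α : ℝ) - 1)) (𝓝 0) (𝓝 0) := by
      have := (Real.continuousAt_rpow_const (0 : ℝ) (2 * (α : ℝ) - 1) (Or.inr hγ.le)).tendsto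
      rwa [Real.zero_rpow hγ.ne'] at this
    simpa using (h1.const_mul ((C : ℝ) ^ 2)).mul_const (b - a)
  obtain ⟨δ, hδε, hδ⟩ := ((hlim.eventually (gt_mem_nhds hε)).filter_mono
    (nhdsWithin_le_nhds (s := Set.Ioi 0))).and self_mem_nhdsWithin |>.exists
  refine ⟨δ, hδ, fun n u c hP hmesh => lt_of_le_of_lt ?_ hδε⟩
  have hmono : ∀ i ≤ n, ∀ j ≤ i, u j ≤ u i := by
    intro i
    induction i with
    | zero => intro _ j hj; rw [Nat.le_zero.1 hj]
    | succ k ih =>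
      intro hk j hj
      rcases Nat.lt_or_ge j (k + 1) with h | h
      · exact (ih (by omega) j (by omega)).trans (hP.step k (by omega))
      · rw [le_antisymm hj h]
  have hu : ∀ i ≤ n, u i ∈ Set.Icc a b := fun i hi =>
    ⟨hP.left ▸ hmono i hi 0 (Nat.zero_le _), hP.right ▸ hmono n le_rfl i hi⟩
  have hc : ∀ i < n, c i ∈ Set.Icc a b := fun i hi =>
    ⟨(hu i hi.le).1.trans (hP.tag i hi).1, (hP.tag i hi).2.trans (hu (i + 1) hi).2⟩
  have htel : (f b ^ 2 - f a ^ 2) / 2 =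
      ∑ i ∈ Finset.range n, (f (u (i + 1)) ^ 2 / 2 - f (u i) ^ 2 / 2) := by
    rw [Finset.sum_range_sub (fun i => f (u i) ^ 2 / 2), hP.left, hP.right]
    ring
  have hlen : b - a = ∑ i ∈ Finset.range n, (u (i + 1) - u i) := by
    rw [Finset.sum_range_sub, hP.left, hP.right]
  rw [htel, ← Finset.sum_sub_distrib]
  refine (Finset.abs_sum_le_sum_abs _ _).trans ?_
  rw [hlen, Finset.mul_sum]
  refine Finset.sum_le_sum fun i hi => ?_
  have hi : i < n := Finset.mem_range.1 hi
  have hd0 : 0 ≤ u (i + 1) - u i := sub_nonneg.2 (hP.step i hi)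
  have h1 : |f (c i) - f (u i)| ≤ C * (u (i + 1) - u i) ^ (α : ℝ) := by
    refine (hdist _ (hc i hi) _ (hu i hi.le)).trans ?_
    gcongr
    rw [abs_of_nonneg (sub_nonneg.2 (hP.tag i hi).1)]
    linarith [(hP.tag i hi).2]
  have h2 : |f (c i) - f (u (i + 1))| ≤ C * (u (i + 1) - u i) ^ (α : ℝ) := by
    refine (hdist _ (hc i hi) _ (hu (i + 1) hi)).trans ?_
    gcongr
    rw [abs_sub_comm, abs_of_nonneg (sub_nonneg.2 (hP.tag i hi).2)]
    linarith [(hP.tag i hi).1]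
  have h3 : |f (u (i + 1)) - f (u i)| ≤ C * (u (i + 1) - u i) ^ (α : ℝ) := by
    refine (hdist _ (hu (i + 1) hi) _ (hu i hi.le)).trans ?_
    rw [abs_of_nonneg hd0]
  -- The error relative to the increment of `f²/2` is the deviation of `f (c i)` from the mean of
  -- the two endpoint values, times the increment of `f`.
  have hsplit : f (c i) * (f (u (i + 1)) - f (u i)) - (f (u (i + 1)) ^ 2 / 2 - f (u i) ^ 2 / 2) =
      (((f (c i) - f (u i)) + (f (c i) - f (u (i + 1)))) / 2) * (f (u (i + 1)) - f (u i)) := by ring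
  have hbd : |((f (c i) - f (u i)) + (f (c i) - f (u (i + 1)))) / 2| ≤
      C * (u (i + 1) - u i) ^ (α : ℝ) := by
    rw [abs_div, abs_two]
    linarith [abs_add_le (f (c i) - f (u i)) (f (c i) - f (u (i + 1)))]
  rw [hsplit, abs_mul]
  calc _ ≤ (C * (u (i + 1) - u i) ^ (α : ℝ)) * (C * (u (i + 1) - u i) ^ (α : ℝ)) := by
        gcongr
    _ = C ^ 2 * (u (i + 1) - u i) ^ (2 * (α : ℝ) - 1) * (u (i + 1) - u i) := by
        rcases hd0.eq_or_lt with h | h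
        · rw [← h, Real.zero_rpow (by linarith)]; ring
        · have : (u (i + 1) - u i) ^ (2 * (α : ℝ) - 1) * (u (i + 1) - u i) =
              (u (i + 1) - u i) ^ (α : ℝ) * (u (i + 1) - u i) ^ (α : ℝ) := by
            rw [← Real.rpow_add h, ← Real.rpow_add_one h.ne']
            ring_nf
          rw [mul_assoc ((C : ℝ) ^ 2), this]
          ring
    _ ≤ C ^ 2 * δ ^ (2 * (α : ℝ) - 1) * (u (i + 1) - u i) := by
        gcongr
        exact (hmesh i hi).le

theorem isYoungIntegral_self {f : ℝ → ℝ} {a b : ℝ} {C α : ℝ≥0}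
    (hα : (1 / 2 : ℝ) < α) (hα1 : α < 1) (hf : HolderOnWith C α f (Set.Icc a b)) :
    IsYoungIntegral f f a b ((f b ^ 2 - f a ^ 2) / 2) := by
  have h0 : 0 < α := by
    rw [← NNReal.coe_pos]
    linarith
  refine ⟨⟨α, α, C, C, h0, hα1, h0, hα1, ?_, hf, hf⟩, isRiemannStieltjesIntegral_self hα hf⟩
  rw [← NNReal.coe_lt_coe]
  push_cast
  linarith

theorem IsYoungIntegral.youngIntegral_eq {f g : ℝ → ℝ} {a b I : ℝ} (hab : a ≤ b)
    (h : IsYoungIntegral f g a b I) : youngIntegral f g a b = I := by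
  have hex : ∃ I, IsYoungIntegral f g a b I := ⟨I, h⟩
  rw [youngIntegral, dif_pos hex]
  exact hex.choose_spec.2.unique hab h.2

/-! ### Linear equations and the energy identity. -/

/-- The solution of `U' = b + c U`, `U 0 = 0`. -/
noncomputable def linearODESolution (c : ℝ) (b : ℝ → ℝ) (t : ℝ) : ℝ :=
  Real.exp (c * t) * ∫ s in (0 : ℝ)..t, Real.exp (-(c * s)) * b s

theorem hasDerivAt_linearODESolution (c : ℝ) {b : ℝ → ℝ} (hb : Continuous b) (t : ℝ) :
    HasDerivAt (linearODESolution c b) (b t + c * linearODESolution c b t) t := by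
  have h1 : HasDerivAt (fun t => Real.exp (c * t)) (Real.exp (c * t) * (c * 1)) t :=
    ((hasDerivAt_id t).const_mul c).exp
  have h2 := (Continuous.integral_hasStrictDerivAt
    (f := fun s => Real.exp (-(c * s)) * b s) (by fun_prop) 0 t).hasDerivAt
  refine (h1.mul h2).congr_deriv ?_
  simp only [linearODESolution]
  rw [← mul_assoc (Real.exp (c * t)) (Real.exp _), ← Real.exp_add, add_neg_cancel, Real.exp_zero]
  ring

theorem continuous_linearODESolution (c : ℝ) {b : ℝ → ℝ} (hb : Continuous b) :
    Continuous (linearODESolution c b) :=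
  continuous_iff_continuousAt.2 fun t => (hasDerivAt_linearODESolution c hb t).continuousAt

@[simp]
theorem linearODESolution_zero (c : ℝ) (b : ℝ → ℝ) : linearODESolution c b 0 = 0 := by
  simp [linearODESolution]

/-- Variation of constants. -/
theorem integral_eq_linearODESolution {θ : ℝ} {b x : ℝ → ℝ} (hx : Continuous x)
    (hb : Continuous b) (h : ∀ t, 0 ≤ t → x t = θ * (∫ s in (0 : ℝ)..t, x s) + b t) {t : ℝ}
    (ht : 0 ≤ t) : ∫ s in (0 : ℝ)..t, x s = linearODESolution θ b t := by
  have key : ∫ s in (0 : ℝ)..t, Real.exp (-(θ * s)) * b s =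
      Real.exp (-(θ * t)) * (∫ s in (0 : ℝ)..t, x s) := by
    rw [intervalIntegral.integral_eq_sub_of_hasDerivAt
      (f := fun t => Real.exp (-(θ * t)) * ∫ s in (0 : ℝ)..t, x s)]
    · simp
    · intro s hs
      rw [Set.uIcc_of_le ht] at hs
      have h1 : HasDerivAt (fun t => Real.exp (-(θ * t))) (Real.exp (-(θ * s)) * -(θ * 1)) s :=
        ((hasDerivAt_id s).const_mul θ).neg.exp
      have h2 := (hx.integral_hasStrictDerivAt 0 s).hasDerivAt
      refine (h1.mul h2).congr_deriv ?_
      rw [h s hs.1]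
      ring
    · exact Continuous.intervalIntegrable (by fun_prop) _ _
  rw [linearODESolution, key, ← mul_assoc, ← Real.exp_add]
  simp

/-- The energy identity for the pair `x = b + θ U`, `y = b - θ V`, where `U' = x` and `V' = y`. -/
theorem sq_linearODESolution_sub_integral (θ : ℝ) {b : ℝ → ℝ} (hb : Continuous b) (t : ℝ) :
    (b t + θ * linearODESolution θ b t) ^ 2 / 2 -
        θ * ∫ s in (0 : ℝ)..t, (b s + θ * linearODESolution θ b s) ^ 2 =
      (b t + θ * linearODESolution θ b t) * (b t - θ * linearODESolution (-θ) b t) -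
        ((b t - θ * linearODESolution (-θ) b t) ^ 2 / 2 +
          θ * ∫ s in (0 : ℝ)..t, (b s - θ * linearODESolution (-θ) b s) ^ 2) := by
  have hU := continuous_linearODESolution θ hb
  have hV := continuous_linearODESolution (-θ) hb
  -- Since `x - y = θ (U + V)` and `x + y = (U + V)'`, the integrand `x² - y²` is the derivative of
  -- `θ (U + V)²/2`.
  have key : ∫ s in (0 : ℝ)..t, ((b s + θ * linearODESolution θ b s) ^ 2 -
      (b s - θ * linearODESolution (-θ) b s) ^ 2) =
      θ * (linearODESolution θ b t + linearODESolution (-θ) b t) ^ 2 / 2 := by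
    rw [intervalIntegral.integral_eq_sub_of_hasDerivAt
      (f := fun t => θ * (linearODESolution θ b t + linearODESolution (-θ) b t) ^ 2 / 2)]
    · simp
    · intro s _
      refine (((((hasDerivAt_linearODESolution θ hb s).add
        (hasDerivAt_linearODESolution (-θ) hb s)).pow 2).const_mul θ).div_const 2).congr_deriv ?_
      simp only [Pi.add_apply]
      push_cast
      ring
    · exact Continuous.intervalIntegrable (by fun_prop) _ _
  rw [intervalIntegral.integral_sub (Continuous.intervalIntegrable (by fun_prop) _ _)
    (Continuous.intervalIntegrable (by fun_prop) _ _)] at key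
  linear_combination (-θ) * key

/-! ### Averages over a stopped exponential time. -/

theorem integral_expMeasure {θ : ℝ} (hθ : 0 < θ) (f : ℝ → ℝ) :
    ∫ s, f s ∂(expMeasure θ) = ∫ s in Set.Ioi 0, θ * Real.exp (-(θ * s)) * f s := by
  have h1 : expMeasure θ = volume.withDensity (exponentialPDF θ) := rfl
  have hm : Measurable (exponentialPDF θ) := (measurable_exponentialPDFReal θ).ennreal_ofReal
  rw [h1, integral_withDensity_eq_integral_toReal_smul hm
    (ae_of_all _ fun _ => ENNReal.ofReal_lt_top), ← integral_indicator measurableSet_Ioi]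
  refine integral_congr_ae ?_
  filter_upwards [Measure.ae_ne volume (0 : ℝ)] with s hs
  rcases lt_or_gt_of_ne hs with h | h
  · simp [exponentialPDF_of_neg h, h.le]
  · rw [Set.indicator_of_mem (Set.mem_Ioi.2 h), exponentialPDF_of_nonneg h.le,
      ENNReal.toReal_ofReal (by positivity), smul_eq_mul]

/-- Averaging over an exponential time stopped at `t`. -/
theorem integral_min_expMeasure {θ t : ℝ} (hθ : 0 < θ) (ht : 0 ≤ t) {f : ℝ → ℝ}
    (hf : Continuous f) :
    ∫ s, f (max 0 (min s t)) ∂(expMeasure θ) =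
      Real.exp (-(θ * t)) * f t + ∫ s in (0 : ℝ)..t, θ * Real.exp (-(θ * s)) * f s := by
  have hexp : IntegrableOn (fun s => θ * Real.exp (-(θ * s))) (Set.Ioi t) := by
    have := (exp_neg_integrableOn_Ioi t hθ).const_mul θ
    simp only [neg_mul] at this
    exact this
  have hint : ∫ s in Set.Ioi t, θ * Real.exp (-(θ * s)) = Real.exp (-(θ * t)) := by
    rw [integral_const_mul]
    have := integral_exp_mul_Ioi (a := -θ) (by linarith) t
    simp only [neg_mul] at this
    rw [this]
    field_simp
  have e2 : Set.EqOn (fun s => θ * Real.exp (-(θ * s)) * f (max 0 (min s t)))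
      (fun s => θ * Real.exp (-(θ * s)) * f t) (Set.Ioi t) := fun s hs => by
    simp only [min_eq_right (Set.mem_Ioi.1 hs).le, max_eq_right ht]
  have e1 : Set.EqOn (fun s => θ * Real.exp (-(θ * s)) * f (max 0 (min s t)))
      (fun s => θ * Real.exp (-(θ * s)) * f s) (Set.Ioc 0 t) := fun s hs => by
    simp only [min_eq_left hs.2, max_eq_right hs.1.le]
  rw [integral_expMeasure hθ, ← Set.Ioc_union_Ioi_eq_Ioi ht, setIntegral_union
    (Set.Ioc_disjoint_Ioi le_rfl) measurableSet_Ioi, setIntegral_congr_fun measurableSet_Ioi e2,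
    setIntegral_congr_fun measurableSet_Ioc e1, integral_mul_const, hint,
    intervalIntegral.integral_of_le ht, add_comm]
  · exact (Continuous.integrableOn_Icc (by fun_prop)).mono_set Set.Ioc_subset_Icc_self
  · exact (integrableOn_congr_fun e2 measurableSet_Ioi).2 (hexp.mul_const _)

/-- The stopped time has an atom of mass `e^{-θt}` at `t`, which produces the term `b t`; its
density on `(0, t)` produces the variation-of-constants integral. This is what turns `e^{-θt} X_t`
into an average of the driving path. -/
theorem integral_min_expMeasure_eq_forward {θ t : ℝ} (hθ : 0 < θ) (ht : 0 ≤ t) {b : ℝ → ℝ}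
    (hb : Continuous b) :
    ∫ s, b (max 0 (min s t)) ∂(expMeasure θ) =
      Real.exp (-(θ * t)) * (b t + θ * linearODESolution θ b t) := by
  rw [integral_min_expMeasure hθ ht hb, linearODESolution, mul_add,
    mul_left_comm _ θ, ← mul_assoc (Real.exp _) (Real.exp _), ← Real.exp_add, neg_add_cancel,
    Real.exp_zero, one_mul, ← intervalIntegral.integral_const_mul]
  simp only [mul_assoc]

/-- The reversal `s ↦ t - s` turns the average into the convolution solving the stable equation. The
atom at `t` contributes `b t - b 0 = b t`, which completes the coefficient of `b t` to `1`. -/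
theorem integral_min_expMeasure_eq_backward {θ t : ℝ} (hθ : 0 < θ) (ht : 0 ≤ t) {b : ℝ → ℝ}
    (hb : Continuous b) (hb0 : b 0 = 0) :
    ∫ s, (b t - b (t - max 0 (min s t))) ∂(expMeasure θ) = b t - θ * linearODESolution (-θ) b t := by
  have h1 : ∫ s in (0 : ℝ)..t, θ * Real.exp (-(θ * s)) = 1 - Real.exp (-(θ * t)) := by
    rw [intervalIntegral.integral_eq_sub_of_hasDerivAt (f := fun s => -Real.exp (-(θ * s)))]
    · simp; ring
    · intro s _
      exact hasDerivAt_neg_exp_mul_exp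
    · exact Continuous.intervalIntegrable (by fun_prop) _ _
  have h2 : ∫ s in (0 : ℝ)..t, θ * Real.exp (-(θ * s)) * b (t - s) =
      θ * linearODESolution (-θ) b t := by
    have := intervalIntegral.integral_comp_sub_left
      (fun s => θ * Real.exp (-(θ * (t - s))) * b s) (a := 0) (b := t) t
    simp only [sub_sub_cancel, sub_self, sub_zero] at this
    rw [this, linearODESolution, ← intervalIntegral.integral_const_mul,
      ← intervalIntegral.integral_const_mul]
    congr 1
    ext s
    rw [show -(θ * (t - s)) = -θ * t + -(-θ * s) by ring, Real.exp_add]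
    ring
  rw [integral_min_expMeasure (f := fun s => b t - b (t - s)) hθ ht (by fun_prop)]
  simp only [sub_self, hb0, sub_zero, mul_sub]
  rw [intervalIntegral.integral_sub (Continuous.intervalIntegrable (by fun_prop) _ _)
    (Continuous.intervalIntegrable (by fun_prop) _ _), h2, intervalIntegral.integral_mul_const, h1]
  ring

/-! ### Hölder continuity of fractional Brownian paths, by dyadic chaining. -/

/-- A continuous function whose dyadic increments of order `n` are `O(2 ^ (-n α))` is Hölder
continuous of order `α`. -/
theorem exists_holder_of_dyadic_increments {g : ℝ → ℝ} (hg : Continuous g) {C α : ℝ} (hα : 0 < α)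
    (h : ∀ n k : ℕ, k < 2 ^ n →
      |g ((k + 1 : ℕ) / 2 ^ n) - g (k / 2 ^ n)| ≤ C * ((1 / 2 : ℝ) ^ α) ^ n) :
    ∃ D, 0 ≤ D ∧ ∀ s ∈ Set.Icc (0 : ℝ) 1, ∀ t ∈ Set.Icc (0 : ℝ) 1, |g s - g t| ≤ D * |s - t| ^ α := by
  set r : ℝ := (1 / 2 : ℝ) ^ α with hr
  have hr0 : 0 < r := by positivity
  have hr1 : r < 1 := Real.rpow_lt_one (by norm_num) (by norm_num) hα
  have hC : 0 ≤ C := by simpa using (abs_nonneg _).trans (h 0 0 (by norm_num))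
  -- Left dyadic approximation of `s` at level `n`; passing to level `n + 1` either leaves it fixed
  -- or moves it by one dyadic step of that level.
  let d : ℕ → ℝ → ℝ := fun n s => (⌊s * 2 ^ n⌋₊ : ℝ) / 2 ^ n
  have hd : ∀ s, 0 ≤ s → Tendsto (fun n => d n s) atTop (𝓝 s) := by
    intro s hs
    have h2 : Tendsto (fun n : ℕ => (2 : ℝ) ^ n) atTop atTop :=
      tendsto_pow_atTop_atTop_of_one_lt (by norm_num)
    exact (tendsto_nat_floor_mul_div_atTop hs).comp h2
  have hpow : ∀ n : ℕ, (0 : ℝ) < 2 ^ n := fun n => by positivity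
  have hstep : ∀ s ∈ Set.Icc (0 : ℝ) 1, ∀ n, dist (g (d n s)) (g (d (n + 1) s)) ≤
      C * r * r ^ n := by
    intro s hs n
    have hfl := Nat.floor_le (mul_nonneg hs.1 (hpow n).le)
    have hlt := Nat.lt_floor_add_one (s * 2 ^ n)
    have hfl' := Nat.floor_le (mul_nonneg hs.1 (hpow (n + 1)).le)
    have hlt' := Nat.lt_floor_add_one (s * 2 ^ (n + 1))
    set a := ⌊s * 2 ^ n⌋₊ with ha
    set b := ⌊s * 2 ^ (n + 1)⌋₊ with hb
    rw [pow_succ] at hfl' hlt'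
    have hb1 : 2 * a < b + 1 := by
      have : (2 * a : ℝ) < b + 1 := by linarith
      exact_mod_cast this
    have hb2 : b < 2 * a + 2 := by
      have : (b : ℝ) < 2 * a + 2 := by linarith
      exact_mod_cast this
    have hda : d n s = ((2 * a : ℕ) : ℝ) / 2 ^ (n + 1) := by
      simp only [d, ← ha]
      rw [pow_succ]
      push_cast
      field_simp
    have hdb : d (n + 1) s = (b : ℝ) / 2 ^ (n + 1) := rfl
    rw [hda, hdb]
    rcases (by omega : b = 2 * a ∨ b = 2 * a + 1) with e | e
    · rw [e, dist_self]; positivity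
    · rw [e, dist_comm, Real.dist_eq, mul_assoc, ← pow_succ']
      apply h
      have hs2 : s * 2 ^ n ≤ 2 ^ n := mul_le_of_le_one_left (hpow n).le hs.2
      have : (b : ℝ) ≤ 2 ^ n * 2 := by linarith
      rw [← pow_succ] at this
      have : b ≤ 2 ^ (n + 1) := by exact_mod_cast this
      omega
  have happ : ∀ s ∈ Set.Icc (0 : ℝ) 1, ∀ n, |g (d n s) - g s| ≤ C * r * r ^ n / (1 - r) :=
    fun s hs n => dist_le_of_le_geometric_of_tendsto r (C * r) hr1 (hstep s hs)
      ((hg.tendsto s).comp (hd s hs.1)) n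
  have hlt : ∀ s ∈ Set.Icc (0 : ℝ) 1, ∀ t ∈ Set.Icc (0 : ℝ) 1, s < t →
      |g s - g t| ≤ (2 * C / (1 - r) + C / r) * |s - t| ^ α := by
    intro s hs t ht hst
    have hts : 0 < t - s := sub_pos.2 hst
    -- The level `m` satisfies `2^{-(m+1)} < t - s ≤ 2^{-m}`: the approximations of `s` and `t` are
    -- then equal or adjacent, and `r^{m+1}` is at most `|s - t|^α`.
    obtain ⟨m, hm1, hm2⟩ := exists_nat_pow_near_of_lt_one hts (by linarith [ht.2, hs.1])
      (by norm_num : (0 : ℝ) < 1 / 2) (by norm_num)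
    have hmid : |g (d m s) - g (d m t)| ≤ C * r ^ m := by
      have hfl := Nat.floor_le (mul_nonneg hs.1 (hpow m).le)
      have hlt := Nat.lt_floor_add_one (s * 2 ^ m)
      have hfl' := Nat.floor_le (mul_nonneg ht.1 (hpow m).le)
      have hlt' := Nat.lt_floor_add_one (t * 2 ^ m)
      simp only [d]
      set a := ⌊s * 2 ^ m⌋₊
      set b := ⌊t * 2 ^ m⌋₊
      have hmul : (t - s) * 2 ^ m ≤ 1 := by
        calc (t - s) * 2 ^ m ≤ (1 / 2) ^ m * 2 ^ m := by gcongr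
          _ = 1 := by rw [← mul_pow]; norm_num
      have hmul' := mul_pos hts (hpow m)
      have hb1 : a < b + 1 := by
        have : (a : ℝ) < b + 1 := by linarith
        exact_mod_cast this
      have hb2 : b < a + 2 := by
        have : (b : ℝ) < a + 2 := by linarith
        exact_mod_cast this
      rcases (by omega : b = a ∨ b = a + 1) with e | e
      · rw [e, sub_self, abs_zero]; positivity
      · rw [e, abs_sub_comm]
        apply h
        have hs2 : t * 2 ^ m ≤ 2 ^ m := mul_le_of_le_one_left (hpow m).le ht.2
        have : (b : ℝ) ≤ 2 ^ m := by linarith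
        have : b ≤ 2 ^ m := by exact_mod_cast this
        omega
    have hrm : r ^ (m + 1) ≤ |s - t| ^ α := by
      rw [abs_sub_comm, abs_of_pos hts, hr, ← Real.rpow_natCast, ← Real.rpow_mul (by norm_num),
        mul_comm, Real.rpow_mul (by norm_num), Real.rpow_natCast]
      gcongr
    have h1r : 0 < 1 - r := by linarith
    have e1 := abs_sub_le (g s) (g (d m s)) (g t)
    have e2 := abs_sub_le (g (d m s)) (g (d m t)) (g t)
    have e3 := happ s hs m
    rw [abs_sub_comm] at e3
    have e4 := happ t ht m
    calc |g s - g t| ≤ C * r * r ^ m / (1 - r) + C * r ^ m + C * r * r ^ m / (1 - r) := by linarith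
      _ = (2 * C / (1 - r) + C / r) * r ^ (m + 1) := by
        rw [pow_succ]
        field_simp
        ring
      _ ≤ _ := by gcongr
  have h1r : 0 < 1 - r := by linarith
  refine ⟨2 * C / (1 - r) + C / r, by positivity, fun s hs t ht => ?_⟩
  rcases lt_trichotomy s t with hst | hst | hst
  · exact hlt s hs t ht hst
  · rw [hst, sub_self, abs_zero]; positivity
  · rw [abs_sub_comm, abs_sub_comm s]
    exact hlt t ht s hs hst

/-- The covariance function of fractional Brownian motion. -/
noncomputable def fbmCov (H s t : ℝ) : ℝ := (s ^ (2 * H) + t ^ (2 * H) - |s - t| ^ (2 * H)) / 2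

section
variable {Ω : Type*} [MeasurableSpace Ω] {P : Measure Ω} {H : ℝ} {B : ℝ≥0 → Ω → ℝ}

theorem ProbabilityTheory.IsGaussianProcess.integrable_mul_eval {T : Type*} {Y : T → Ω → ℝ}
    (hY : IsGaussianProcess Y P) (s t : T) : Integrable (fun ω => Y s ω * Y t ω) P :=
  (hY.hasGaussianLaw_eval s).memLp_two.integrable_mul (hY.hasGaussianLaw_eval t).memLp_two

theorem ProbabilityTheory.HasGaussianLaw.hasLaw_gaussianReal_zero {Y : Ω → ℝ} (hY : HasGaussianLaw Y P)
    (h0 : ∫ ω, Y ω ∂P = 0) : HasLaw Y (gaussianReal 0 (∫ ω, Y ω ^ 2 ∂P).toNNReal) P where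
  aemeasurable := hY.aemeasurable
  map_eq := by
    rw [hY.map_eq_gaussianReal, h0, variance_of_integral_eq_zero hY.aemeasurable h0]

namespace IsFractionalBrownianMotion

theorem covariance_eq (hB : IsFractionalBrownianMotion H B P) (s t : ℝ≥0) :
    ∫ ω, B s ω * B t ω ∂P = fbmCov H s t := hB.covariance s t

theorem integral_sub_sq (hB : IsFractionalBrownianMotion H B P) (hH : 0 < H) (s t : ℝ≥0) :
    ∫ ω, (B s ω - B t ω) ^ 2 ∂P = |(s : ℝ) - t| ^ (2 * H) := by
  have hi := hB.gaussian.integrable_mul_eval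
  have hz : (0 : ℝ) ^ (2 * H) = 0 := Real.zero_rpow (by positivity)
  have : ∀ ω, (B s ω - B t ω) ^ 2 = B s ω * B s ω - 2 * (B s ω * B t ω) + B t ω * B t ω := by
    intro ω; ring
  simp_rw [this]
  rw [integral_add (by exact (hi s s).sub ((hi s t).const_mul 2)) (hi t t),
    integral_sub (hi s s) ((hi s t).const_mul 2), integral_const_mul, hB.covariance,
    hB.covariance, hB.covariance, sub_self, sub_self, abs_zero, hz]
  ring

theorem hasLaw_sub (hB : IsFractionalBrownianMotion H B P) (hH : 0 < H) (s t : ℝ≥0) :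
    HasLaw (fun ω => B s ω - B t ω) (gaussianReal 0 (|(s : ℝ) - t| ^ (2 * H)).toNNReal) P := by
  have h := HasGaussianLaw.hasLaw_gaussianReal_zero
    (hB.gaussian.hasGaussianLaw_fun_sub (s := s) (t := t)) ?_
  · rwa [hB.integral_sub_sq hH] at h
  · rw [integral_sub (hB.gaussian.hasGaussianLaw_eval s).integrable
      (hB.gaussian.hasGaussianLaw_eval t).integrable, hB.centered, hB.centered, sub_zero]

end IsFractionalBrownianMotion

theorem lintegral_abs_pow_gaussianReal (v : ℝ≥0) (p : ℕ) :
    ∫⁻ x, ENNReal.ofReal (|x| ^ p) ∂(gaussianReal 0 v) =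
      ENNReal.ofReal ((√(v : ℝ)) ^ p) * ∫⁻ x, ENNReal.ofReal (|x| ^ p) ∂(gaussianReal 0 1) := by
  have h : gaussianReal 0 v = (gaussianReal 0 1).map (√(v : ℝ) * ·) := by
    rw [gaussianReal_map_const_mul]
    simp only [mul_zero, mul_one]
    congr 1
    ext
    simp
  rw [h, lintegral_map (by fun_prop) (by fun_prop), ← lintegral_const_mul _ (by fun_prop)]
  congr 1
  ext x
  rw [← ENNReal.ofReal_mul (by positivity), abs_mul, mul_pow, abs_of_nonneg (Real.sqrt_nonneg _)]

theorem lintegral_abs_pow_gaussianReal_lt_top (p : ℕ) :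
    ∫⁻ x, ENNReal.ofReal (|x| ^ p) ∂(gaussianReal 0 1) < ⊤ := by
  have h : Integrable (fun x : ℝ => |x| ^ p) (gaussianReal 0 1) := by
    have := (memLp_id_gaussianReal (μ := 0) (v := 1) (p : ℝ≥0)).integrable_norm_pow'
    simpa using this
  exact h.lintegral_lt_top

namespace IsFractionalBrownianMotion

theorem lintegral_abs_sub_pow (hB : IsFractionalBrownianMotion H B P) (hH : 0 < H) (s t : ℝ≥0)
    (p : ℕ) : ∫⁻ ω, ENNReal.ofReal (|B s ω - B t ω| ^ p) ∂P =
      ENNReal.ofReal ((|(s : ℝ) - t| ^ H) ^ p) *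
        ∫⁻ x, ENNReal.ofReal (|x| ^ p) ∂(gaussianReal 0 1) := by
  have hl := hB.hasLaw_sub hH s t
  rw [show (∫⁻ ω, ENNReal.ofReal (|B s ω - B t ω| ^ p) ∂P) =
    ∫⁻ x, ENNReal.ofReal (|x| ^ p) ∂(P.map fun ω => B s ω - B t ω) from
    (lintegral_map' (f := fun x : ℝ => ENNReal.ofReal (|x| ^ p)) (by fun_prop) hl.aemeasurable).symm, hl.map_eq, lintegral_abs_pow_gaussianReal,
    Real.coe_toNNReal _ (by positivity), mul_comm 2 H, Real.rpow_mul (by positivity),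
    Real.rpow_two, Real.sqrt_sq (by positivity)]

/-- The paths of fractional Brownian motion are Hölder continuous of any order below `H`. -/
theorem ae_exists_holder (hB : IsFractionalBrownianMotion H B P) {α : ℝ} (hα : 0 < α)
    (hαH : α < H) (T : ℝ≥0) :
    ∀ᵐ ω ∂P, ∃ D, 0 ≤ D ∧ ∀ s ∈ Set.Icc (0 : ℝ) 1, ∀ t ∈ Set.Icc (0 : ℝ) 1,
      |samplePath B ω (T * s) - samplePath B ω (T * t)| ≤ D * |s - t| ^ α := by
  have hH : 0 < H := hα.trans hαH
  -- With `p (H - α) > 1`, the `2^n` increments of level `n`, each normalized and raised to the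
  -- power `p`, have total expectation of order `q^n` with `q = 2^{1-(H-α)p} < 1`.
  obtain ⟨p, hp⟩ := exists_nat_gt (1 / (H - α))
  rw [div_lt_iff₀ (by linarith)] at hp
  have hp0 : p ≠ 0 := by rintro rfl; simp at hp; linarith
  set M := ∫⁻ x, ENNReal.ofReal (|x| ^ p) ∂(gaussianReal 0 1) with hM
  have hMtop : M < ⊤ := lintegral_abs_pow_gaussianReal_lt_top p
  set r : ℝ := (1 / 2 : ℝ) ^ α with hr
  have hr0 : 0 < r := by positivity
  let u : ℕ → ℕ → ℝ≥0 := fun n k => T * (k / 2 ^ n)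
  let f : ℕ → ℕ → Ω → ENNReal := fun n k ω =>
    ENNReal.ofReal ((1 / r ^ n) ^ p) * ENNReal.ofReal (|B (u n (k + 1)) ω - B (u n k) ω| ^ p)
  have hfm : ∀ n k, AEMeasurable (f n k) P := fun n k => by
    have h1 := hB.gaussian.aemeasurable (u n (k + 1))
    have h2 := hB.gaussian.aemeasurable (u n k)
    simp only [f]
    fun_prop
  set q : ℝ := 2 * ((1 / 2 : ℝ) ^ (H - α)) ^ p with hq
  have hq1 : q < 1 := by
    have : ((1 / 2 : ℝ) ^ (H - α)) ^ p < 1 / 2 := by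
      rw [← Real.rpow_natCast, ← Real.rpow_mul (by norm_num)]
      calc (1 / 2 : ℝ) ^ ((H - α) * p) < (1 / 2) ^ (1 : ℝ) :=
            Real.rpow_lt_rpow_of_exponent_gt (by norm_num) (by norm_num) (by linarith)
        _ = 1 / 2 := by simp
    linarith
  have hfi : ∀ n k, ∫⁻ ω, f n k ω ∂P =
      ENNReal.ofReal (((T : ℝ) ^ H) ^ p * (((1 / 2 : ℝ) ^ (H - α)) ^ p) ^ n) * M := by
    intro n k
    have hr' : AEMeasurable (fun ω => ENNReal.ofReal (|B (u n (k + 1)) ω - B (u n k) ω| ^ p)) P := by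
      have h1 := hB.gaussian.aemeasurable (u n (k + 1))
      have h2 := hB.gaussian.aemeasurable (u n k)
      fun_prop
    rw [lintegral_const_mul'' _ hr', hB.lintegral_abs_sub_pow hH, ← mul_assoc,
      ← ENNReal.ofReal_mul (by positivity)]
    congr 2
    have hdiff : |((u n (k + 1) : ℝ≥0) : ℝ) - u n k| = T * (1 / 2) ^ n := by
      have : ((u n (k + 1) : ℝ≥0) : ℝ) - u n k = T * (1 / 2) ^ n := by
        simp only [u]
        push_cast
        rw [one_div, inv_pow]
        field_simp
        ring
      rw [this, abs_of_nonneg (by positivity)]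
    have hpw : (((1 / 2 : ℝ)) ^ n) ^ H = ((1 / 2 : ℝ) ^ H) ^ n := by
      rw [← Real.rpow_natCast, ← Real.rpow_mul (by norm_num), mul_comm,
        Real.rpow_mul (by norm_num), Real.rpow_natCast]
    rw [hdiff, Real.mul_rpow (by positivity) (by positivity), hpw, Real.rpow_sub (by norm_num),
      ← hr, ← pow_mul _ p n, mul_comm p n, pow_mul _ n p, ← mul_pow, ← mul_pow]
    congr 1
    rw [div_pow]
    ring
  have hsum : ∫⁻ ω, ∑' n, ∑ k ∈ Finset.range (2 ^ n), f n k ω ∂P ≠ ⊤ := by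
    rw [lintegral_tsum (fun n => Finset.aemeasurable_fun_sum _ fun k _ => hfm n k)]
    have : ∀ n, ∫⁻ ω, ∑ k ∈ Finset.range (2 ^ n), f n k ω ∂P =
        ENNReal.ofReal (((T : ℝ) ^ H) ^ p * q ^ n) * M := by
      intro n
      rw [lintegral_finsetSum' _ (fun k _ => hfm n k)]
      simp only [hfi, Finset.sum_const, Finset.card_range, nsmul_eq_mul]
      rw [← mul_assoc, ← ENNReal.ofReal_natCast, ← ENNReal.ofReal_mul (by positivity), hq, mul_pow]
      congr 2
      push_cast
      ring
    simp_rw [this]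
    rw [ENNReal.tsum_mul_right, ← ENNReal.ofReal_tsum_of_nonneg (fun n => by positivity)
      ((summable_geometric_of_lt_one (by positivity) hq1).mul_left _)]
    exact ENNReal.mul_ne_top ENNReal.ofReal_ne_top hMtop.ne
  have hae := ae_lt_top' (AEMeasurable.tsum
    (fun n => Finset.aemeasurable_fun_sum (Finset.range (2 ^ n)) fun k _ => hfm n k)) hsum
  filter_upwards [hae, hB.continuous_paths] with ω hω hc
  set S := ∑' n, ∑ k ∈ Finset.range (2 ^ n), f n k ω with hS
  have hcont : Continuous fun s => samplePath B ω (T * s) := by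
    have : Continuous fun s : ℝ => ((T : ℝ) * s).toNNReal := by fun_prop
    exact hc.comp this
  refine exists_holder_of_dyadic_increments (C := S.toReal + 1) hcont hα fun n k hk => ?_
  have hle : f n k ω ≤ S :=
    (Finset.single_le_sum (f := fun k => f n k ω) (fun _ _ => zero_le) (Finset.mem_range.2 hk)).trans
      (ENNReal.le_tsum n)
  have hu : ∀ j : ℕ, ((T : ℝ) * (j / 2 ^ n)).toNNReal = u n j := by
    intro j
    rw [← Real.toNNReal_coe (r := u n j)]
    simp [u]
  simp only [samplePath]
  rw [hu, hu]
  simp only [f] at hle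
  rw [← ENNReal.ofReal_mul (by positivity), ← mul_pow,
    ← ENNReal.ofReal_toReal hω.ne, ENNReal.ofReal_le_ofReal_iff ENNReal.toReal_nonneg] at hle
  set y := |B (u n (k + 1)) ω - B (u n k) ω| with hy
  have hy0 : 0 ≤ 1 / r ^ n * y := by positivity
  -- A normalized increment `z` satisfies `z ^ p ≤ S`; if `z > 1` then `z ≤ z ^ p`, and otherwise `z
  -- ≤ 1`.
  have : 1 / r ^ n * y ≤ S.toReal + 1 := by
    rcases le_or_gt (1 / r ^ n * y) 1 with h1 | h1
    · linarith [ENNReal.toReal_nonneg (a := S)]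
    · linarith [le_self_pow₀ h1.le hp0]
  rw [one_div, inv_mul_le_iff₀ (by positivity)] at this
  linarith

end IsFractionalBrownianMotion
end

/-! ### Integrals of Gaussian processes over the parameter. -/

/-- Simple functions on the real line converging pointwise to the identity. -/
noncomputable def idApprox (n : ℕ) : SimpleFunc ℝ ℝ :=
  SimpleFunc.approxOn id measurable_id Set.univ 0 (Set.mem_univ _) n

theorem tendsto_idApprox (s : ℝ) : Tendsto (fun n => idApprox n s) atTop (𝓝 s) :=
  SimpleFunc.tendsto_approxOn measurable_id (Set.mem_univ _) (by simp)

theorem MeasureTheory.SimpleFunc.integral_comp_eq_sum {α β : Type*} [MeasurableSpace α]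
    (μ : Measure α) [IsFiniteMeasure μ] (f : SimpleFunc α β) (g : β → ℝ) :
    ∫ s, g (f s) ∂μ = ∑ x ∈ f.range, μ.real (f ⁻¹' {x}) * g x := by
  classical
  have h : ∀ s, g (f s) = ∑ x ∈ f.range, (f ⁻¹' {x}).indicator (fun _ => g x) s := by
    intro s
    rw [Finset.sum_eq_single (f s)]
    · simp
    · intro x _ hx
      exact Set.indicator_of_notMem (fun h => hx h.symm) _
    · intro h
      exact absurd (f.mem_range_self s) h
  simp_rw [h]
  rw [integral_finsetSum _ fun x _ =>
    (integrable_const (g x)).indicator (f.measurableSet_fiber x)]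
  refine Finset.sum_congr rfl fun x _ => ?_
  rw [integral_indicator_const _ (f.measurableSet_fiber x), smul_eq_mul]

/-- Presents a parameter integral of a path as a limit of finite combinations of its values.
Measurability, moment bounds and Gaussianity can then be inherited from finite sums, with no joint
measurability in `(s, ω)`. -/
theorem tendsto_sum_idApprox (μ : Measure ℝ) [IsFiniteMeasure μ] {y : ℝ → ℝ} (hc : Continuous y)
    (hb : ∃ C, ∀ s, |y s| ≤ C) :
    Tendsto (fun n => ∑ x ∈ (idApprox n).range, μ.real (idApprox n ⁻¹' {x}) * y x) atTop
      (𝓝 (∫ s, y s ∂μ)) := by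
  obtain ⟨C, hC⟩ := hb
  simp_rw [← SimpleFunc.integral_comp_eq_sum]
  refine tendsto_integral_of_dominated_convergence (fun _ => C) (fun n => ?_)
    (integrable_const C) (fun n => ae_of_all _ fun s => hC _)
    (ae_of_all _ fun s => (hc.tendsto s).comp (tendsto_idApprox s))
  exact (hc.measurable.comp (idApprox n).measurable).aestronglyMeasurable

section
variable {Ω : Type*} [MeasurableSpace Ω] {P : Measure Ω} {Y : ℝ → Ω → ℝ}
  {μ : Measure ℝ}

theorem aemeasurable_integral_of_continuous [IsFiniteMeasure μ] (hY : ∀ s, AEMeasurable (Y s) P)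
    (hc : ∀ᵐ ω ∂P, Continuous (fun s => Y s ω) ∧ ∃ C, ∀ s, |Y s ω| ≤ C) :
    AEMeasurable (fun ω => ∫ s, Y s ω ∂μ) P := by
  refine aemeasurable_of_tendsto_metrizable_ae atTop (f := fun n ω =>
    ∑ x ∈ (idApprox n).range, μ.real (idApprox n ⁻¹' {x}) * Y x ω) (fun n => ?_) ?_
  · exact Finset.aemeasurable_fun_sum _ fun x _ => (hY x).const_mul _
  · filter_upwards [hc] with ω hω
    exact tendsto_sum_idApprox μ hω.1 hω.2

/-- A one-sided Tonelli bound: it holds for the finite sums by linearity and passes to the limit by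
Fatou. -/
theorem lintegral_integral_le_of_continuous [IsFiniteMeasure μ] (hY : ∀ s, AEMeasurable (Y s) P)
    (hc : ∀ᵐ ω ∂P, Continuous (fun s => Y s ω) ∧ ∃ C, ∀ s, |Y s ω| ≤ C)
    (h0 : ∀ s ω, 0 ≤ Y s ω) {c : ENNReal} (hle : ∀ s, ∫⁻ ω, ENNReal.ofReal (Y s ω) ∂P ≤ c) :
    ∫⁻ ω, ENNReal.ofReal (∫ s, Y s ω ∂μ) ∂P ≤ μ Set.univ * c := by
  let J : ℕ → Ω → ENNReal := fun n ω =>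
    ∑ x ∈ (idApprox n).range, μ (idApprox n ⁻¹' {x}) * ENNReal.ofReal (Y x ω)
  have hJ : ∀ n ω, J n ω =
      ENNReal.ofReal (∑ x ∈ (idApprox n).range, μ.real (idApprox n ⁻¹' {x}) * Y x ω) := by
    intro n ω
    rw [ENNReal.ofReal_sum_of_nonneg fun x _ => mul_nonneg measureReal_nonneg (h0 x ω)]
    refine Finset.sum_congr rfl fun x _ => ?_
    rw [ENNReal.ofReal_mul measureReal_nonneg, ofReal_measureReal]
  have hterm : ∀ n x, AEMeasurable
      (fun ω => μ (idApprox n ⁻¹' {x}) * ENNReal.ofReal (Y x ω)) P := fun n x =>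
    (hY x).ennreal_ofReal.const_mul _
  have hJm : ∀ n, AEMeasurable (J n) P := fun n =>
    Finset.aemeasurable_fun_sum _ fun x _ => hterm n x
  have hJle : ∀ n, ∫⁻ ω, J n ω ∂P ≤ μ Set.univ * c := by
    intro n
    simp only [J]
    rw [lintegral_finsetSum' _ fun x _ => hterm n x]
    calc _ ≤ ∑ x ∈ (idApprox n).range, μ (idApprox n ⁻¹' {x}) * c := by
          refine Finset.sum_le_sum fun x _ => ?_
          rw [lintegral_const_mul'' _ (hY x).ennreal_ofReal]
          gcongr
          exact hle x
      _ = μ Set.univ * c := by rw [← Finset.sum_mul, SimpleFunc.sum_range_measure_preimage_singleton]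
  calc ∫⁻ ω, ENNReal.ofReal (∫ s, Y s ω ∂μ) ∂P
      = ∫⁻ ω, liminf (fun n => J n ω) atTop ∂P := by
        refine lintegral_congr_ae ?_
        filter_upwards [hc] with ω hω
        refine (Tendsto.liminf_eq ?_).symm
        simp_rw [hJ]
        exact ENNReal.tendsto_ofReal (tendsto_sum_idApprox μ hω.1 hω.2)
    _ ≤ liminf (fun n => ∫⁻ ω, J n ω ∂P) atTop := lintegral_liminf_le' hJm
    _ ≤ liminf (fun _ => μ Set.univ * c) atTop :=
        liminf_le_liminf (Eventually.of_forall hJle)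
    _ = μ Set.univ * c := liminf_const _

/-- The integral of a bounded continuous centered Gaussian process is a centered Gaussian random
variable, whose variance is the double integral of the covariance. -/
theorem hasLaw_integral_of_isGaussianProcess [IsProbabilityMeasure P] [IsFiniteMeasure μ]
    (hY : IsGaussianProcess Y P) (h0 : ∀ s, ∫ ω, Y s ω ∂P = 0)
    (hc : ∀ᵐ ω ∂P, Continuous (fun s => Y s ω) ∧ ∃ C, ∀ s, |Y s ω| ≤ C)
    {K : ℝ → ℝ → ℝ} (hK : ∀ s t, ∫ ω, Y s ω * Y t ω ∂P = K s t)
    (hKc : Continuous fun p : ℝ × ℝ => K p.1 p.2) (hKb : ∃ C, ∀ s t, |K s t| ≤ C) :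
    HasLaw (fun ω => ∫ s, Y s ω ∂μ)
      (gaussianReal 0 (∫ p : ℝ × ℝ, K p.1 p.2 ∂(μ.prod μ)).toNNReal) P := by
  obtain ⟨C, hC⟩ := hKb
  set V := ∫ p : ℝ × ℝ, K p.1 p.2 ∂(μ.prod μ) with hV
  let I : ℕ → Ω → ℝ := fun n ω =>
    ∑ x ∈ (idApprox n).range, μ.real (idApprox n ⁻¹' {x}) * Y x ω
  let v : ℕ → ℝ := fun n => ∫ p : ℝ × ℝ, K (idApprox n p.1) (idApprox n p.2) ∂(μ.prod μ)
  have hKm : ∀ n, AEStronglyMeasurable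
      (fun p : ℝ × ℝ => K (idApprox n p.1) (idApprox n p.2)) (μ.prod μ) := by
    intro n
    have : Measurable fun p : ℝ × ℝ => (idApprox n p.1, idApprox n p.2) :=
      ((idApprox n).measurable.comp measurable_fst).prodMk
        ((idApprox n).measurable.comp measurable_snd)
    exact (hKc.measurable.comp this).aestronglyMeasurable
  have hv : Tendsto v atTop (𝓝 V) := by
    refine tendsto_integral_of_dominated_convergence (fun _ => C) hKm
      (integrable_const C) (fun n => ae_of_all _ fun s => hC _ _) (ae_of_all _ fun p => ?_)
    exact (hKc.tendsto p).comp ((tendsto_idApprox p.1).prodMk_nhds (tendsto_idApprox p.2))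
  have hI2 : ∀ n, ∫ ω, I n ω ^ 2 ∂P = v n := by
    intro n
    have h1 : v n = ∑ x ∈ (idApprox n).range, μ.real (idApprox n ⁻¹' {x}) *
        ∑ y ∈ (idApprox n).range, μ.real (idApprox n ⁻¹' {y}) * K x y := by
      have hint : Integrable (fun p : ℝ × ℝ => K (idApprox n p.1) (idApprox n p.2)) (μ.prod μ) :=
        Integrable.of_bound (hKm n) C (ae_of_all _ fun p => hC _ _)
      simp only [v]
      rw [integral_prod _ hint]
      simp only [SimpleFunc.integral_comp_eq_sum μ (idApprox n) (K (idApprox n _))]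
      exact SimpleFunc.integral_comp_eq_sum μ (idApprox n) fun x =>
        ∑ y ∈ (idApprox n).range, μ.real (idApprox n ⁻¹' {y}) * K x y
    have h2 : ∀ ω, I n ω ^ 2 = ∑ x ∈ (idApprox n).range, ∑ y ∈ (idApprox n).range,
        μ.real (idApprox n ⁻¹' {x}) * μ.real (idApprox n ⁻¹' {y}) * (Y x ω * Y y ω) := by
      intro ω
      rw [sq, Finset.sum_mul_sum]
      refine Finset.sum_congr rfl fun x _ => Finset.sum_congr rfl fun y _ => by ring
    simp_rw [h2]
    rw [h1, integral_finsetSum _ fun x _ => integrable_finsetSum _ fun y _ =>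
      (hY.integrable_mul_eval x y).const_mul _]
    refine Finset.sum_congr rfl fun x _ => ?_
    rw [integral_finsetSum _ fun y _ => (hY.integrable_mul_eval x y).const_mul _, Finset.mul_sum]
    refine Finset.sum_congr rfl fun y _ => ?_
    rw [integral_const_mul, hK, mul_assoc]
  have hIlaw : ∀ n, HasLaw (I n) (gaussianReal 0 (v n).toNNReal) P := by
    intro n
    have h := (hY.smul fun x => μ.real (idApprox n ⁻¹' {x})).hasGaussianLaw_fun_sum
      (I := (idApprox n).range)
    have h' := HasGaussianLaw.hasLaw_gaussianReal_zero h ?_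
    · simpa [I, ← hI2] using h'
    · simp only [smul_eq_mul]
      rw [integral_finsetSum _ fun x _ => (hY.hasGaussianLaw_eval x).integrable.const_mul _]
      simp [integral_const_mul, h0]
  have hm : AEMeasurable (fun ω => ∫ s, Y s ω ∂μ) P :=
    aemeasurable_integral_of_continuous hY.aemeasurable hc
  -- Almost sure convergence of the sums gives convergence of their Gaussian characteristic
  -- functions; the variances converge to `V`, so uniqueness of limits identifies the law.
  have hdist : TendstoInDistribution I atTop (fun ω => ∫ s, Y s ω ∂μ) (fun _ => P) P := by
    refine tendstoInDistribution_of_ae_tendsto (fun n => (hIlaw n).aemeasurable) hm ?_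
    filter_upwards [hc] with ω hω
    exact tendsto_sum_idApprox μ hω.1 hω.2
  refine ⟨hm, ?_⟩
  have := Measure.isProbabilityMeasure_map hm
  refine Measure.ext_of_charFun (funext fun ξ => ?_)
  have hl := ProbabilityMeasure.tendsto_iff_tendsto_charFun.1 hdist.tendsto ξ
  refine tendsto_nhds_unique hl ?_
  simp only [ProbabilityMeasure.coe_mk, (hIlaw _).map_eq, charFun_gaussianReal]
  have hv' : Tendsto (fun n => (((v n).toNNReal : ℝ) : ℂ)) atTop (𝓝 ((V.toNNReal : ℝ) : ℂ)) :=
    (Complex.continuous_ofReal.tendsto _).comp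
      ((NNReal.continuous_coe.tendsto _).comp ((continuous_real_toNNReal.tendsto _).comp hv))
  exact (Complex.continuous_exp.tendsto _).comp
    (tendsto_const_nhds.sub ((hv'.mul_const _).div_const _))

end

/-! ### Asymptotics of the covariance and the limiting variance. -/

/-- Mean value inequality on `[x - u, x]`, where the derivative is eventually small. The denominator
`u + 1` in the proof also covers `u = 0`. -/
theorem tendsto_sub_comp_sub_of_deriv {f f' : ℝ → ℝ} (hf : ∀ᶠ x in atTop, HasDerivAt f (f' x) x)
    (hf' : Tendsto f' atTop (𝓝 0)) (u : ℝ) (hu : 0 ≤ u) :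
    Tendsto (fun x => f x - f (x - u)) atTop (𝓝 0) := by
  rw [Metric.tendsto_nhds]
  intro ε hε
  have h1 : ∀ᶠ x in atTop, ‖f' x‖ ≤ ε / (u + 1) := by
    have := (Metric.tendsto_nhds.1 hf') (ε / (u + 1)) (by positivity)
    filter_upwards [this] with x hx
    rw [dist_zero_right] at hx
    exact hx.le
  obtain ⟨N, hN⟩ := eventually_atTop.1 (hf.and h1)
  filter_upwards [eventually_ge_atTop (N + u)] with x hx
  have h := (convex_Ici N).norm_image_sub_le_of_norm_hasDerivWithin_le (f := f) (f' := f')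
    (C := ε / (u + 1)) (fun y hy => (hN y hy).1.hasDerivWithinAt) (fun y hy => (hN y hy).2)
    (x := x - u) (y := x) (Set.mem_Ici.2 (by linarith)) (Set.mem_Ici.2 (by linarith))
  rw [dist_zero_right]
  refine h.trans_lt ?_
  rw [sub_sub_cancel, Real.norm_of_nonneg hu, div_mul_eq_mul_div, div_lt_iff₀ (by linarith)]
  nlinarith

/-- Second differences of `x ^ p` vanish at infinity when `p < 2`. -/
theorem tendsto_second_difference_rpow {p : ℝ} (h2 : p < 2) {u v : ℝ} (hu : 0 ≤ u)
    (hv : 0 ≤ v) :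
    Tendsto (fun x : ℝ => (x ^ p - (x - v) ^ p) - ((x - u) ^ p - (x - u - v) ^ p)) atTop (𝓝 0) := by
  -- Two uses of the difference lemma: the derivative of the first difference is `p` times a first
  -- difference of `x^{p-1}`, whose own derivative is of order `x^{p-2}`.
  have hq : Tendsto (fun x : ℝ => x ^ (p - 1) - (x - v) ^ (p - 1)) atTop (𝓝 0) := by
    refine tendsto_sub_comp_sub_of_deriv (f := fun x => x ^ (p - 1))
      (f' := fun x => (p - 1) * x ^ (p - 1 - 1)) ?_ ?_ v hv
    · filter_upwards [eventually_gt_atTop 0] with x hx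
      exact Real.hasDerivAt_rpow_const (Or.inl hx.ne')
    · have := (tendsto_rpow_neg_atTop (y := 2 - p) (by linarith)).const_mul (p - 1)
      rw [mul_zero] at this
      refine this.congr fun x => ?_
      ring_nf
  refine tendsto_sub_comp_sub_of_deriv (f := fun x => x ^ p - (x - v) ^ p)
    (f' := fun x => p * (x ^ (p - 1) - (x - v) ^ (p - 1))) ?_ ?_ u hu
  · filter_upwards [eventually_gt_atTop (max 0 v)] with x hx
    have hx0 : 0 < x := (le_max_left _ _).trans_lt hx
    have hxv : 0 < x - v := sub_pos.2 ((le_max_right _ _).trans_lt hx)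
    refine ((Real.hasDerivAt_rpow_const (Or.inl hx0.ne')).sub
      (((hasDerivAt_id x).sub_const v).rpow_const (Or.inl hxv.ne'))).congr_deriv ?_
    simp only [id]
    ring
  · simpa using hq.const_mul p

theorem ae_pos_expMeasure (θ : ℝ) : ∀ᵐ s ∂(expMeasure θ), 0 < s := by
  have h1 : expMeasure θ = volume.withDensity (exponentialPDF θ) := rfl
  have hm : Measurable (exponentialPDF θ) := (measurable_exponentialPDFReal θ).ennreal_ofReal
  rw [h1, ae_withDensity_iff hm]
  filter_upwards [Measure.ae_ne volume (0 : ℝ)] with s hs h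
  by_contra hneg
  exact h (exponentialPDF_of_neg (lt_of_le_of_ne (not_lt.1 hneg) hs))

theorem integrable_rpow_expMeasure {θ p : ℝ} (hθ : 0 < θ) (hp : 0 ≤ p) :
    Integrable (fun s => |s| ^ p) (expMeasure θ) := by
  have h1 : expMeasure θ = volume.withDensity (exponentialPDF θ) := rfl
  have hm : Measurable (exponentialPDF θ) := (measurable_exponentialPDFReal θ).ennreal_ofReal
  rw [h1, integrable_withDensity_iff hm (ae_of_all _ fun _ => ENNReal.ofReal_lt_top)]
  have h := (integrableOn_rpow_mul_exp_neg_mul_rpow (s := p) (p := 1) (by linarith) one_pos hθ).const_mul θ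
  replace h := (integrable_indicator_iff measurableSet_Ioi).2 h
  refine h.congr ?_
  filter_upwards [Measure.ae_ne volume (0 : ℝ)] with s hs
  rcases lt_or_gt_of_ne hs with h | h
  · simp [exponentialPDF_of_neg h, h.le]
  · rw [Set.indicator_of_mem (Set.mem_Ioi.2 h), exponentialPDF_of_nonneg h.le,
      ENNReal.toReal_ofReal (by positivity), abs_of_pos h, Real.rpow_one]
    ring_nf

theorem continuous_fbmCov {H : ℝ} (hH : 0 < H) : Continuous fun p : ℝ × ℝ => fbmCov H p.1 p.2 := by
  have h : ∀ f : ℝ × ℝ → ℝ, Continuous f → Continuous fun p => f p ^ (2 * H) := fun f hf =>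
    hf.rpow_const fun _ => Or.inr (by positivity)
  unfold fbmCov
  exact (((h _ continuous_fst).add (h _ continuous_snd)).sub
    (h _ (continuous_fst.sub continuous_snd).abs)).div_const 2

theorem fbmCov_pos {H s t : ℝ} (hH : 0 < H) (hs : 0 < s) (ht : 0 < t) : 0 < fbmCov H s t := by
  have hp : 0 < 2 * H := by positivity
  have h : |s - t| ^ (2 * H) < s ^ (2 * H) + t ^ (2 * H) := by
    have h1 := Real.rpow_pos_of_pos hs (2 * H)
    have h2 := Real.rpow_pos_of_pos ht (2 * H)
    rcases le_total t s with h | h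
    · rw [abs_of_nonneg (sub_nonneg.2 h)]
      have := Real.rpow_le_rpow (sub_nonneg.2 h) (by linarith : s - t ≤ s) hp.le
      linarith
    · rw [abs_sub_comm, abs_of_nonneg (sub_nonneg.2 h)]
      have := Real.rpow_le_rpow (sub_nonneg.2 h) (by linarith : t - s ≤ t) hp.le
      linarith
  unfold fbmCov
  linarith

theorem fbmCov_le (H s t : ℝ) : fbmCov H s t ≤ (s ^ (2 * H) + t ^ (2 * H)) / 2 := by
  have : 0 ≤ |s - t| ^ (2 * H) := by positivity
  unfold fbmCov
  linarith

section
variable {θ H : ℝ}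

theorem integrable_fst_add_snd_expMeasure (hθ : 0 < θ) (hH : 0 < H) :
    Integrable (fun p : ℝ × ℝ => |p.1| ^ (2 * H) + |p.2| ^ (2 * H))
      ((expMeasure θ).prod (expMeasure θ)) := by
  have := isProbabilityMeasure_expMeasure hθ
  have h := integrable_rpow_expMeasure (p := 2 * H) hθ (by positivity)
  exact (h.comp_fst _).add (h.comp_snd _)

theorem ae_pos_prod_expMeasure (hθ : 0 < θ) :
    ∀ᵐ p : ℝ × ℝ ∂((expMeasure θ).prod (expMeasure θ)), 0 < p.1 ∧ 0 < p.2 := by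
  have := isProbabilityMeasure_expMeasure hθ
  exact (Measure.quasiMeasurePreserving_fst.ae (ae_pos_expMeasure θ)).and
    (Measure.quasiMeasurePreserving_snd.ae (ae_pos_expMeasure θ))

/-- The limiting variance `θ² ∫∫ e^{-θ (s + t)} R(s, t) ds dt`. -/
noncomputable def limitVariance (θ H : ℝ) : ℝ :=
  ∫ p : ℝ × ℝ, fbmCov H p.1 p.2 ∂((expMeasure θ).prod (expMeasure θ))

theorem integrable_fbmCov (hθ : 0 < θ) (hH : 0 < H) :
    Integrable (fun p : ℝ × ℝ => fbmCov H p.1 p.2) ((expMeasure θ).prod (expMeasure θ)) := by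
  refine (integrable_fst_add_snd_expMeasure hθ hH).mono'
    (continuous_fbmCov hH).aestronglyMeasurable ?_
  filter_upwards [ae_pos_prod_expMeasure hθ] with p hp
  rw [Real.norm_of_nonneg (fbmCov_pos hH hp.1 hp.2).le, abs_of_pos hp.1, abs_of_pos hp.2]
  have h1 := Real.rpow_pos_of_pos hp.1 (2 * H)
  have h2 := Real.rpow_pos_of_pos hp.2 (2 * H)
  linarith [fbmCov_le H p.1 p.2]

/-- The covariance is strictly positive at positive times. Nondegeneracy matters because the first
limiting Gaussian ends up in a denominator. -/
theorem limitVariance_pos (hθ : 0 < θ) (hH : 0 < H) : 0 < limitVariance θ H := by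
  have := isProbabilityMeasure_expMeasure hθ
  have hpos := ae_pos_prod_expMeasure hθ
  have h0 : 0 ≤ᵐ[(expMeasure θ).prod (expMeasure θ)] fun p : ℝ × ℝ => fbmCov H p.1 p.2 := by
    filter_upwards [hpos] with p hp
    exact (fbmCov_pos hH hp.1 hp.2).le
  refine lt_of_le_of_ne (integral_nonneg_of_ae h0) fun h => ?_
  have h2 := (integral_eq_zero_iff_of_nonneg_ae h0 (integrable_fbmCov hθ hH)).1 h.symm
  obtain ⟨p, hp, hp0⟩ := (hpos.and h2).exists
  exact (fbmCov_pos hH hp.1 hp.2).ne' hp0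

/-- The covariance of `a B_c + b (B_t - B_{t - c})`, with `c = max 0 (min s t)`. -/
noncomputable def mixedCov (H t a b s r : ℝ) : ℝ :=
  (a ^ 2 + b ^ 2) * fbmCov H (max 0 (min s t)) (max 0 (min r t)) +
    a * b * ((fbmCov H (max 0 (min s t)) t - fbmCov H (max 0 (min s t)) (t - max 0 (min r t))) +
      (fbmCov H (max 0 (min r t)) t - fbmCov H (max 0 (min r t)) (t - max 0 (min s t))))

theorem continuous_mixedCov (hH : 0 < H) (t a b : ℝ) :
    Continuous fun p : ℝ × ℝ => mixedCov H t a b p.1 p.2 := by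
  have h : ∀ f g : ℝ × ℝ → ℝ, Continuous f → Continuous g →
      Continuous fun p => fbmCov H (f p) (g p) := fun f g hf hg =>
    (continuous_fbmCov hH).comp (hf.prodMk hg)
  have h1 : Continuous fun p : ℝ × ℝ => max 0 (min p.1 t) := by fun_prop
  have h2 : Continuous fun p : ℝ × ℝ => max 0 (min p.2 t) := by fun_prop
  unfold mixedCov
  exact ((h _ _ h1 h2).const_mul _).add
    ((((h _ _ h1 continuous_const).sub (h _ _ h1 (continuous_const.sub h2))).add
      ((h _ _ h2 continuous_const).sub (h _ _ h2 (continuous_const.sub h1)))).const_mul _)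

/-- Asymptotic decorrelation of the beginning of the path from its last increments: for large `t`
the difference is half a second difference of `x^{2H}`. -/
theorem tendsto_fbmCov_sub (h2 : H < 1) {u v : ℝ} (hu : 0 ≤ u) (hv : 0 ≤ v) :
    Tendsto (fun t : ℝ => fbmCov H u t - fbmCov H u (t - v)) atTop (𝓝 0) := by
  have h := (tendsto_second_difference_rpow (p := 2 * H) (by linarith) hv hu).div_const 2
  rw [zero_div] at h
  refine h.congr' ?_
  filter_upwards [eventually_ge_atTop (u + v)] with t ht
  rw [fbmCov, fbmCov, abs_sub_comm u t, abs_of_nonneg (by linarith), abs_sub_comm u,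
    abs_of_nonneg (by linarith)]
  ring

theorem tendsto_mixedCov (h2 : H < 1) (a b : ℝ) {s r : ℝ} (hs : 0 < s)
    (hr : 0 < r) :
    Tendsto (fun t : ℝ => mixedCov H t a b s r) atTop (𝓝 ((a ^ 2 + b ^ 2) * fbmCov H s r)) := by
  have h : Tendsto (fun t : ℝ => (a ^ 2 + b ^ 2) * fbmCov H s r +
      a * b * ((fbmCov H s t - fbmCov H s (t - r)) + (fbmCov H r t - fbmCov H r (t - s)))) atTop
      (𝓝 ((a ^ 2 + b ^ 2) * fbmCov H s r + a * b * (0 + 0))) :=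
    tendsto_const_nhds.add (((tendsto_fbmCov_sub h2 hs.le hr.le).add
      (tendsto_fbmCov_sub h2 hr.le hs.le)).const_mul _)
  rw [add_zero, mul_zero, add_zero] at h
  refine h.congr' ?_
  filter_upwards [eventually_ge_atTop (max s r)] with t ht
  rw [mixedCov, min_eq_left ((le_max_left _ _).trans ht), min_eq_left ((le_max_right _ _).trans ht),
    max_eq_right hs.le, max_eq_right hr.le]

end

section
variable {Ω : Type*} [MeasurableSpace Ω] {P : Measure Ω} {θ H : ℝ} {B : ℝ≥0 → Ω → ℝ}

/-- The process `a B_c + b (B_t - B_{t - c})`, with `c = max 0 (min s t)`. -/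
noncomputable def mixedPath (B : ℝ≥0 → Ω → ℝ) (t : ℝ≥0) (a b s : ℝ) (ω : Ω) : ℝ :=
  a * samplePath B ω (max 0 (min s t)) +
    b * (samplePath B ω t - samplePath B ω (t - max 0 (min s t)))

namespace IsFractionalBrownianMotion

theorem isGaussianProcess_mixedPath (hB : IsFractionalBrownianMotion H B P) (t : ℝ≥0)
    (a b : ℝ) : IsGaussianProcess (mixedPath B t a b) P := by
  classical
  refine hB.gaussian.of_isGaussianProcess fun s => ?_
  refine ⟨{(max 0 (min s t)).toNNReal, (t : ℝ).toNNReal, (t - max 0 (min s t)).toNNReal},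
    a • ContinuousLinearMap.proj ⟨(max 0 (min s t)).toNNReal, by simp⟩ +
      b • (ContinuousLinearMap.proj ⟨(t : ℝ).toNNReal, by simp⟩ -
        ContinuousLinearMap.proj ⟨(t - max 0 (min s t)).toNNReal, by simp⟩), fun ω => ?_⟩
  simp [mixedPath, samplePath]

theorem integral_mixedPath (hB : IsFractionalBrownianMotion H B P) (t : ℝ≥0) (a b s : ℝ) :
    ∫ ω, mixedPath B t a b s ω ∂P = 0 := by
  have hi : ∀ u : ℝ, Integrable (fun ω => samplePath B ω u) P := fun u =>
    (hB.gaussian.hasGaussianLaw_eval u.toNNReal).integrable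
  have h0 : ∀ u : ℝ, ∫ ω, samplePath B ω u ∂P = 0 := fun u => hB.centered u.toNNReal
  have hsub : ∀ u v : ℝ, Integrable (fun ω => samplePath B ω u - samplePath B ω v) P :=
    fun u v => (hi u).sub (hi v)
  unfold mixedPath
  rw [integral_add ((hi _).const_mul a) ((hsub _ _).const_mul b), integral_const_mul,
    integral_const_mul, integral_sub (hi _) (hi _), h0, h0, h0]
  simp

/-- Increments looking back from `t` have the same covariance as `B` itself, which is why `a² + b²`
multiplies a single `fbmCov` in `mixedCov`. -/
theorem integral_mixedPath_mul (hB : IsFractionalBrownianMotion H B P) (hH : 0 < H) (t : ℝ≥0)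
    (a b s r : ℝ) :
    ∫ ω, mixedPath B t a b s ω * mixedPath B t a b r ω ∂P = mixedCov H t a b s r := by
  have hi : ∀ u v : ℝ, Integrable (fun ω => samplePath B ω u * samplePath B ω v) P := fun u v =>
    hB.gaussian.integrable_mul_eval u.toNNReal v.toNNReal
  have hcov : ∀ u v : ℝ, 0 ≤ u → 0 ≤ v →
      ∫ ω, samplePath B ω u * samplePath B ω v ∂P = fbmCov H u v := by
    intro u v hu hv
    have := hB.covariance_eq u.toNNReal v.toNNReal
    rwa [Real.coe_toNNReal _ hu, Real.coe_toNNReal _ hv] at this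
  set c := max 0 (min s (t : ℝ)) with hc
  set d := max 0 (min r (t : ℝ)) with hd
  have ht : (0 : ℝ) ≤ t := t.2
  have hc0 : 0 ≤ c := le_max_left _ _
  have hd0 : 0 ≤ d := le_max_left _ _
  have hct : 0 ≤ t - c := sub_nonneg.2 (max_le ht (min_le_right _ _))
  have hdt : 0 ≤ t - d := sub_nonneg.2 (max_le ht (min_le_right _ _))
  -- Each factor is a combination of three values of `B` with weights `a, b, -b`, so the product
  -- expands into nine covariances.
  let x : Fin 3 → ℝ := ![c, t, t - c]
  let y : Fin 3 → ℝ := ![d, t, t - d]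
  let w : Fin 3 → ℝ := ![a, b, -b]
  have hx : ∀ i, 0 ≤ x i := by
    intro i; fin_cases i <;> simp [x, hc0, sub_nonneg.1 hct]
  have hy : ∀ i, 0 ≤ y i := by
    intro i; fin_cases i <;> simp [y, hd0, sub_nonneg.1 hdt]
  have hprod : ∀ ω, mixedPath B t a b s ω * mixedPath B t a b r ω =
      ∑ i, ∑ j, w i * w j * (samplePath B ω (x i) * samplePath B ω (y j)) := by
    intro ω
    simp only [mixedPath, ← hc, ← hd, Fin.sum_univ_three, x, y, w, Matrix.cons_val_zero,
      Matrix.cons_val_one, Matrix.cons_val]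
    ring
  simp_rw [hprod]
  rw [integral_finsetSum _ fun i _ => integrable_finsetSum _ fun j _ => (hi _ _).const_mul _]
  simp_rw [fun i => integral_finsetSum (μ := P) Finset.univ
    (f := fun j ω => w i * w j * (samplePath B ω (x i) * samplePath B ω (y j)))
    fun j _ => (hi _ _).const_mul _, integral_const_mul, fun i j => hcov (x i) (y j) (hx i) (hy j)]
  simp only [Fin.sum_univ_three, x, y, w, Matrix.cons_val_zero,
      Matrix.cons_val_one, Matrix.cons_val]
  rw [mixedCov, ← hc, ← hd]
  have e1 : |c - t| = t - c := by rw [abs_sub_comm, abs_of_nonneg hct]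
  have e2 : |d - t| = t - d := by rw [abs_sub_comm, abs_of_nonneg hdt]
  have e3 : |t - d| = t - d := abs_of_nonneg hdt
  have e4 : |t - (t - d)| = d := by rw [sub_sub_cancel, abs_of_nonneg hd0]
  have e5 : |t - c - t| = c := by rw [sub_sub_cancel_left, abs_neg, abs_of_nonneg hc0]
  have e6 : |t - c - (t - d)| = |c - d| := by
    rw [show (t : ℝ) - c - (t - d) = -(c - d) by ring, abs_neg]
  have e7 : |t - c - d| = |c - (t - d)| := by
    rw [show (t : ℝ) - c - d = -(c - (t - d)) by ring, abs_neg]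
  have e8 : |d - (t - c)| = |c - (t - d)| := by
    rw [show d - ((t : ℝ) - c) = c - (t - d) by ring]
  have e9 : |(t : ℝ) - t| ^ (2 * H) = 0 := by
    rw [sub_self, abs_zero, Real.zero_rpow (by positivity)]
  simp only [fbmCov, e1, e2, e3, e4, e5, e6, e7, e8, e9]
  ring

end IsFractionalBrownianMotion
end

/-! ### Continuous mapping and the Cauchy law as a Gaussian ratio. -/

/-- **Continuous mapping theorem** for a function that is almost surely continuous at the limit. -/
theorem MeasureTheory.TendstoInDistribution.comp_of_ae_continuousAt {Ω Ω' ι E F : Type*}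
    [MeasurableSpace Ω] [MeasurableSpace Ω'] {P : Measure Ω} [IsProbabilityMeasure P]
    {P' : Measure Ω'} [IsProbabilityMeasure P'] [TopologicalSpace E] [MeasurableSpace E]
    [OpensMeasurableSpace E] [HasOuterApproxClosed E] [TopologicalSpace F] [MeasurableSpace F]
    [BorelSpace F] [HasOuterApproxClosed F] {X : ι → Ω → E} {Z : Ω' → E} {l : Filter ι}
    [l.IsCountablyGenerated] {g : E → F} (hg : Measurable g)
    (h : TendstoInDistribution X l Z (fun _ => P) P') (hgc : ∀ᵐ ω ∂P', ContinuousAt g (Z ω)) :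
    TendstoInDistribution (fun i ω => g (X i ω)) l (fun ω => g (Z ω)) (fun _ => P) P' where
  forall_aemeasurable i := hg.comp_aemeasurable (h.forall_aemeasurable i)
  aemeasurable_limit := hg.comp_aemeasurable h.aemeasurable_limit
  tendsto := by
    refine tendsto_of_forall_isClosed_limsup_le' fun C hC => ?_
    have hX := h.forall_aemeasurable
    have hZ := h.aemeasurable_limit
    have hcl := ProbabilityMeasure.limsup_measure_closed_le_of_tendsto h.tendsto
      (isClosed_closure (s := g ⁻¹' C))
    simp only [ProbabilityMeasure.coe_mk] at hcl ⊢
    have e1 : ∀ i, (P.map fun ω => g (X i ω)) C ≤ (P.map (X i)) (closure (g ⁻¹' C)) := by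
      intro i
      rw [Measure.map_apply_of_aemeasurable (f := fun ω => g (X i ω)) (hg.comp_aemeasurable (hX i)) hC.measurableSet,
        Measure.map_apply_of_aemeasurable (hX i) isClosed_closure.measurableSet]
      exact measure_mono fun ω hω => subset_closure hω
    have e2 : (P'.map Z) (closure (g ⁻¹' C)) ≤ (P'.map fun ω => g (Z ω)) C := by
      rw [Measure.map_apply_of_aemeasurable (f := fun ω => g (Z ω)) (hg.comp_aemeasurable hZ) hC.measurableSet,
        Measure.map_apply_of_aemeasurable hZ isClosed_closure.measurableSet]
      -- If `Z ω` lies in the closure of the preimage of the closed set `C` and `g` is continuous at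
      -- `Z ω`, then `g (Z ω) ∈ C`.
      refine measure_mono_ae ?_
      filter_upwards [hgc] with ω hω hmem
      exact hC.closure_subset (hω.continuousWithinAt.mem_closure hmem (Set.mapsTo_preimage g C))
    exact (limsup_le_limsup (Eventually.of_forall e1)).trans (hcl.trans e2)

theorem lintegral_abs_mul_exp_neg_mul_sq {c : ℝ} (hc : 0 < c) :
    ∫⁻ x : ℝ, ENNReal.ofReal (|x| * Real.exp (-c * x ^ 2)) = ENNReal.ofReal c⁻¹ := by
  have h1 : ∫ x in Set.Ioi (0 : ℝ), x * Real.exp (-c * x ^ 2) = (2 * c)⁻¹ := by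
    have := integral_mul_cexp_neg_mul_sq (b := (c : ℂ)) (by simpa)
    rw [← Complex.ofReal_inj, ← integral_complex_ofReal]
    push_cast
    exact this
  have h2 : ∫ x : ℝ, |x| * Real.exp (-c * x ^ 2) = c⁻¹ := by
    have := integral_comp_abs (f := fun x : ℝ => x * Real.exp (-c * x ^ 2))
    simp only [sq_abs] at this
    rw [this, h1]
    field_simp
  have hi : Integrable (fun x : ℝ => |x| * Real.exp (-c * x ^ 2)) := by
    refine Integrable.of_integral_ne_zero ?_
    rw [h2]
    positivity
  rw [← ofReal_integral_eq_lintegral_ofReal hi (ae_of_all _ fun x => by positivity), h2]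

/-- The ratio of two independent centered Gaussian variables with the same variance has the
standard Cauchy distribution. -/
theorem map_div_prod_gaussianReal {v : ℝ≥0} (hv : v ≠ 0) :
    ((gaussianReal 0 v).prod (gaussianReal 0 v)).map (fun p => p.2 / p.1) = cauchyMeasure 0 1 := by
  have hvpos : (0 : ℝ) < v := by positivity
  ext S hS
  have hm : Measurable fun p : ℝ × ℝ => p.2 / p.1 := by fun_prop
  rw [Measure.map_apply hm hS, Measure.prod_apply (hm hS),
    cauchyMeasure_of_scale_ne_zero _ one_ne_zero, withDensity_apply _ hS,
    gaussianReal_of_var_ne_zero _ hv,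
    lintegral_withDensity_eq_lintegral_mul _ (measurable_gaussianPDF 0 v)
      (measurable_measure_prodMk_left (hm hS))]
  -- Given the first coordinate `x`, the ratio is centered Gaussian of variance `v / x²`; this is
  -- the resulting joint density of first coordinate and ratio.
  have key : ∀ x : ℝ, x ≠ 0 → ∀ u, gaussianPDF 0 v x *
      gaussianPDF 0 (v / .mk (x ^ 2) (sq_nonneg _)) u = ENNReal.ofReal ((2 * Real.pi * v)⁻¹) *
        ENNReal.ofReal (|x| * Real.exp (-((1 + u ^ 2) / (2 * v)) * x ^ 2)) := by
    intro x hx u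
    rw [gaussianPDF, gaussianPDF, ← ENNReal.ofReal_mul (gaussianPDFReal_nonneg _ _ _),
      ← ENNReal.ofReal_mul (by positivity)]
    congr 1
    simp only [gaussianPDFReal, NNReal.coe_div, NNReal.coe_mk, sub_zero]
    have h1 : √(2 * Real.pi * (v / x ^ 2)) = √(2 * Real.pi * v) / |x| := by
      rw [← mul_div_assoc, Real.sqrt_div (by positivity), Real.sqrt_sq_eq_abs]
    have h2 : √(2 * Real.pi * v) * √(2 * Real.pi * v) = 2 * Real.pi * v :=
      Real.mul_self_sqrt (by positivity)
    have h3 : Real.exp (-x ^ 2 / (2 * v)) * Real.exp (-u ^ 2 / (2 * (v / x ^ 2))) =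
        Real.exp (-((1 + u ^ 2) / (2 * v)) * x ^ 2) := by
      rw [← Real.exp_add]
      congr 1
      field_simp
      ring
    rw [h1, ← h3]
    calc _ = (√(2 * Real.pi * v) * √(2 * Real.pi * v))⁻¹ * |x| *
          (Real.exp (-x ^ 2 / (2 * v)) * Real.exp (-u ^ 2 / (2 * (v / x ^ 2)))) := by
            rw [inv_div, mul_inv]; ring
      _ = _ := by rw [h2]; ring
  have hfib : ∀ x : ℝ, x ≠ 0 → gaussianPDF 0 v x *
      (volume.withDensity (gaussianPDF 0 v)) (Prod.mk x ⁻¹' ((fun p : ℝ × ℝ => p.2 / p.1) ⁻¹' S)) =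
      ∫⁻ u in S, ENNReal.ofReal ((2 * Real.pi * v)⁻¹) *
        ENNReal.ofReal (|x| * Real.exp (-((1 + u ^ 2) / (2 * v)) * x ^ 2)) := by
    intro x hx
    have hvx : v / .mk (x ^ 2) (sq_nonneg _) ≠ 0 := by
      refine div_ne_zero hv fun h => ?_
      have := congrArg NNReal.toReal h
      simp [hx] at this
    have h1 : (volume.withDensity (gaussianPDF 0 v))
        (Prod.mk x ⁻¹' ((fun p : ℝ × ℝ => p.2 / p.1) ⁻¹' S)) =
        ((gaussianReal 0 v).map (· / x)) S := by
      rw [Measure.map_apply (by fun_prop) hS, gaussianReal_of_var_ne_zero _ hv]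
      rfl
    rw [h1, gaussianReal_map_div_const, zero_div, gaussianReal_apply _ hvx,
      ← lintegral_const_mul _ (measurable_gaussianPDF _ _)]
    exact lintegral_congr fun u => key x hx u
  calc _ = ∫⁻ x : ℝ, ∫⁻ u in S, ENNReal.ofReal ((2 * Real.pi * v)⁻¹) *
        ENNReal.ofReal (|x| * Real.exp (-((1 + u ^ 2) / (2 * v)) * x ^ 2)) := by
        refine lintegral_congr_ae ?_
        filter_upwards [Measure.ae_ne volume (0 : ℝ)] with x hx
        exact hfib x hx
    _ = ∫⁻ u in S, ∫⁻ x : ℝ, ENNReal.ofReal ((2 * Real.pi * v)⁻¹) *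
        ENNReal.ofReal (|x| * Real.exp (-((1 + u ^ 2) / (2 * v)) * x ^ 2)) := by
        rw [lintegral_lintegral_swap]
        fun_prop
    _ = _ := by
        -- Integrating out `x` with `c = (1 + u²) / (2v)` leaves `(2πv)⁻¹ · 2v / (1 + u²)`, the
        -- Cauchy density.
        refine lintegral_congr fun u => ?_
        rw [lintegral_const_mul _ (by fun_prop), lintegral_abs_mul_exp_neg_mul_sq (by positivity),
          ← ENNReal.ofReal_mul (by positivity), cauchyPDF, cauchyPDFReal]
        congr 1
        have : (1 : ℝ) + u ^ 2 ≠ 0 := by positivity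
        simp only [sub_zero, NNReal.coe_one, one_pow, mul_one]
        rw [add_comm (u ^ 2)]
        field_simp

/-! ### The two averages and their joint limit. -/

theorem exists_bound_comp_clamp {f : ℝ → ℝ} (hf : Continuous f) {t : ℝ} (ht : 0 ≤ t) :
    ∃ C, ∀ s, |f (max 0 (min s t))| ≤ C := by
  obtain ⟨C, hC⟩ := isCompact_Icc.exists_bound_of_continuousOn (s := Set.Icc 0 t) hf.continuousOn
  exact ⟨C, fun s => hC _ ⟨le_max_left _ _, max_le ht (min_le_right _ _)⟩⟩

theorem continuous_samplePath {Ω : Type*} {X : ℝ≥0 → Ω → ℝ} {ω : Ω}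
    (h : Continuous fun t => X t ω) : Continuous (samplePath X ω) :=
  h.comp continuous_real_toNNReal

/-- The average of the path of `B` up to an independent exponential time stopped at `t`. -/
noncomputable def forwardAverage {Ω : Type*} (θ : ℝ) (B : ℝ≥0 → Ω → ℝ) (t : ℝ≥0) (ω : Ω) : ℝ :=
  ∫ s, samplePath B ω (max 0 (min s t)) ∂(expMeasure θ)

/-- The average of the increments of `B` back from time `t`. -/
noncomputable def backwardAverage {Ω : Type*} (θ : ℝ) (B : ℝ≥0 → Ω → ℝ) (t : ℝ≥0) (ω : Ω) : ℝ :=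
  ∫ s, (samplePath B ω t - samplePath B ω (t - max 0 (min s t))) ∂(expMeasure θ)

/-- The remainder term in the expansion of the estimation error. -/
noncomputable def errorRemainder {Ω : Type*} (θ : ℝ) (B : ℝ≥0 → Ω → ℝ) (t : ℝ≥0) (ω : Ω) : ℝ :=
  Real.exp (-(θ * t)) * (backwardAverage θ B t ω ^ 2 / 2 +
    θ * ∫ s in (0 : ℝ)..t, samplePath (backwardAverage θ B) ω s ^ 2)

theorem exists_continuous_eq_backwardAverage {Ω : Type*} {θ : ℝ} {B : ℝ≥0 → Ω → ℝ}
    (hθ : 0 < θ) {ω : Ω}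
    (hω : Continuous (samplePath B ω)) (h0 : samplePath B ω 0 = 0) :
    ∃ A : ℝ → ℝ, Continuous A ∧ ∀ t : ℝ≥0, backwardAverage θ B t ω = A t :=
  ⟨fun t => samplePath B ω t - θ * linearODESolution (-θ) (samplePath B ω) t,
    hω.sub ((continuous_linearODESolution _ hω).const_mul θ),
    fun t => integral_min_expMeasure_eq_backward hθ (NNReal.coe_nonneg t) hω h0⟩

theorem integral_sq_eq_clamp (f : ℝ → ℝ) (t : ℝ≥0) :
    ∫ s in (0 : ℝ)..t, f s ^ 2 = ∫ s in Set.Ioc (0 : ℝ) t, f (max 0 (min s t)) ^ 2 := by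
  rw [intervalIntegral.integral_of_le (NNReal.coe_nonneg t)]
  refine setIntegral_congr_fun measurableSet_Ioc fun s hs => ?_
  simp only [min_eq_left hs.2, max_eq_right hs.1.le]

namespace IsFractionalBrownianMotion
variable {Ω : Type*} [MeasurableSpace Ω] {P : Measure Ω} {θ H : ℝ} {B : ℝ≥0 → Ω → ℝ}

/-- Both `B_c` and `B_t - B_{t-c}` have variance `c^{2H}`; Cauchy–Schwarz bounds the variance of
their combination, and `|xy| ≤ (x² + y²)/2` the covariance. For fixed `t` this makes the covariance
bounded; dropping the clamp gives a dominating function independent of `t`. -/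
theorem abs_mixedCov_le_clamp (hB : IsFractionalBrownianMotion H B P) (hH : 0 < H) (t : ℝ≥0)
    (a b s r : ℝ) : |mixedCov H t a b s r| ≤
      (a ^ 2 + b ^ 2) * ((max 0 (min s (t : ℝ))) ^ (2 * H) + (max 0 (min r (t : ℝ))) ^ (2 * H)) := by
  have hG := hB.isGaussianProcess_mixedPath t a b
  have hvar : ∀ s, ∫ ω, mixedPath B t a b s ω ^ 2 ∂P ≤
      2 * (a ^ 2 + b ^ 2) * (max 0 (min s (t : ℝ))) ^ (2 * H) := by
    intro s
    set c := max 0 (min s (t : ℝ)) with hc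
    have hc0 : 0 ≤ c := le_max_left _ _
    have hct : 0 ≤ t - c := sub_nonneg.2 (max_le (NNReal.coe_nonneg t) (min_le_right _ _))
    have i1 : Integrable (fun ω => samplePath B ω c ^ 2) P :=
      (hB.gaussian.hasGaussianLaw_eval c.toNNReal).memLp_two.integrable_sq
    have i2 : Integrable (fun ω => (samplePath B ω t - samplePath B ω (t - c)) ^ 2) P :=
      (hB.gaussian.hasGaussianLaw_fun_sub (s := (t : ℝ).toNNReal)
        (t := (t - c).toNNReal)).memLp_two.integrable_sq
    have e1 : ∫ ω, samplePath B ω c ^ 2 ∂P = c ^ (2 * H) := by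
      have := hB.covariance_eq c.toNNReal c.toNNReal
      simp only [sq]
      refine this.trans ?_
      rw [Real.coe_toNNReal _ hc0, fbmCov, sub_self, abs_zero, Real.zero_rpow (by positivity)]
      ring
    have e2 : ∫ ω, (samplePath B ω t - samplePath B ω (t - c)) ^ 2 ∂P = c ^ (2 * H) := by
      have := hB.integral_sub_sq hH (t : ℝ).toNNReal (t - c).toNNReal
      refine this.trans ?_
      rw [Real.coe_toNNReal _ hct, Real.coe_toNNReal _ (NNReal.coe_nonneg t), sub_sub_cancel, abs_of_nonneg hc0]
    calc ∫ ω, mixedPath B t a b s ω ^ 2 ∂P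
        ≤ ∫ ω, (a ^ 2 + b ^ 2) * (samplePath B ω c ^ 2 +
            (samplePath B ω t - samplePath B ω (t - c)) ^ 2) ∂P := by
          refine integral_mono (hG.hasGaussianLaw_eval s).memLp_two.integrable_sq
            ((i1.add i2).const_mul _) fun ω => ?_
          simp only [mixedPath, ← hc]
          nlinarith [sq_nonneg (a * (samplePath B ω t - samplePath B ω (t - c)) -
            b * samplePath B ω c)]
      _ = 2 * (a ^ 2 + b ^ 2) * c ^ (2 * H) := by
          rw [integral_const_mul, integral_add i1 i2, e1, e2]
          ring
  rw [← hB.integral_mixedPath_mul hH]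
  have i1 : ∀ s, Integrable (fun ω => mixedPath B t a b s ω ^ 2) P := fun s =>
    (hG.hasGaussianLaw_eval s).memLp_two.integrable_sq
  calc _ ≤ ∫ ω, |mixedPath B t a b s ω * mixedPath B t a b r ω| ∂P :=
        abs_integral_le_integral_abs
    _ ≤ ∫ ω, (mixedPath B t a b s ω ^ 2 + mixedPath B t a b r ω ^ 2) / 2 ∂P := by
        refine integral_mono (hG.integrable_mul_eval s r).abs
          (((i1 s).add (i1 r)).div_const 2) fun ω => ?_
        simp only [abs_mul]
        nlinarith [sq_nonneg (|mixedPath B t a b s ω| - |mixedPath B t a b r ω|),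
          sq_abs (mixedPath B t a b s ω), sq_abs (mixedPath B t a b r ω)]
    _ ≤ _ := by
        rw [integral_div, integral_add (i1 s) (i1 r)]
        linarith [hvar s, hvar r]

theorem abs_mixedCov_le (hB : IsFractionalBrownianMotion H B P) (hH : 0 < H) (t : ℝ≥0)
    (a b s r : ℝ) :
    |mixedCov H t a b s r| ≤ (a ^ 2 + b ^ 2) * (|s| ^ (2 * H) + |r| ^ (2 * H)) := by
  refine (hB.abs_mixedCov_le_clamp hH t a b s r).trans ?_
  have h : ∀ s : ℝ, (max 0 (min s (t : ℝ))) ^ (2 * H) ≤ |s| ^ (2 * H) := fun s =>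
    Real.rpow_le_rpow (le_max_left _ _)
      (max_le (abs_nonneg s) ((min_le_left _ _).trans (le_abs_self s))) (by positivity)
  exact mul_le_mul_of_nonneg_left (add_le_add (h s) (h r)) (by positivity)

/-- The combination is one integral of the Gaussian process `mixedPath`. Having arbitrary `a, b` is
what allows the Cramér–Wold argument for the pair. -/
theorem hasLaw_average [IsProbabilityMeasure P] (hB : IsFractionalBrownianMotion H B P)
    (hH : 0 < H) (hθ : 0 < θ) (t : ℝ≥0) (a b : ℝ) :
    HasLaw (fun ω => a * forwardAverage θ B t ω + b * backwardAverage θ B t ω)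
      (gaussianReal 0 (∫ p : ℝ × ℝ, mixedCov H t a b p.1 p.2
        ∂((expMeasure θ).prod (expMeasure θ))).toNNReal) P := by
  have := isProbabilityMeasure_expMeasure hθ
  have hpath : ∀ ω, Continuous (samplePath B ω) →
      Continuous fun s => mixedPath B t a b s ω := by
    intro ω hω
    unfold mixedPath
    fun_prop
  have hlaw := hasLaw_integral_of_isGaussianProcess (μ := expMeasure θ)
    (hB.isGaussianProcess_mixedPath t a b) (hB.integral_mixedPath t a b) ?_
    (hB.integral_mixedPath_mul hH t a b) (continuous_mixedCov hH t a b) ?_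
  · refine hlaw.congr ?_
    filter_upwards [hB.continuous_paths] with ω hω
    have hc := continuous_samplePath hω
    have hi : ∀ f : ℝ → ℝ, Continuous f →
        Integrable (fun s => f (max 0 (min s t))) (expMeasure θ) := by
      intro f hf
      obtain ⟨C, hC⟩ := exists_bound_comp_clamp hf (NNReal.coe_nonneg t)
      exact Integrable.of_bound (by fun_prop) C (ae_of_all _ hC)
    simp only [mixedPath, forwardAverage, backwardAverage]
    rw [integral_add ((hi _ hc).const_mul a)
      ((hi (fun s => samplePath B ω t - samplePath B ω (t - s)) (by fun_prop)).const_mul b),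
      integral_const_mul, integral_const_mul]
  · filter_upwards [hB.continuous_paths] with ω hω
    have hc := continuous_samplePath hω
    refine ⟨hpath ω hc, ?_⟩
    exact exists_bound_comp_clamp (f := fun s => a * samplePath B ω s +
      b * (samplePath B ω t - samplePath B ω (t - s))) (by fun_prop) (NNReal.coe_nonneg t)
  · refine ⟨(a ^ 2 + b ^ 2) * ((t : ℝ) ^ (2 * H) + (t : ℝ) ^ (2 * H)), fun s r => ?_⟩
    refine (hB.abs_mixedCov_le_clamp hH t a b s r).trans ?_
    have h : ∀ s : ℝ, (max 0 (min s (t : ℝ))) ^ (2 * H) ≤ (t : ℝ) ^ (2 * H) := fun s =>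
      Real.rpow_le_rpow (le_max_left _ _) (max_le (NNReal.coe_nonneg t) (min_le_right _ _)) (by positivity)
    exact mul_le_mul_of_nonneg_left (add_le_add (h s) (h r)) (by positivity)

theorem tendsto_integral_mixedCov (hB : IsFractionalBrownianMotion H B P)
    (hH : 0 < H) (hH1 : H < 1) (hθ : 0 < θ) (a b : ℝ) :
    Tendsto (fun t : ℝ≥0 => ∫ p : ℝ × ℝ, mixedCov H t a b p.1 p.2
      ∂((expMeasure θ).prod (expMeasure θ))) atTop
      (𝓝 ((a ^ 2 + b ^ 2) * limitVariance θ H)) := by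
  rw [limitVariance, ← integral_const_mul]
  refine tendsto_integral_filter_of_dominated_convergence
    (fun p => (a ^ 2 + b ^ 2) * (|p.1| ^ (2 * H) + |p.2| ^ (2 * H)))
    (Eventually.of_forall fun t => (continuous_mixedCov hH t a b).aestronglyMeasurable)
    (Eventually.of_forall fun t => ae_of_all _ fun p => hB.abs_mixedCov_le hH t a b p.1 p.2)
    ((integrable_fst_add_snd_expMeasure hθ hH).const_mul _) ?_
  filter_upwards [ae_pos_prod_expMeasure hθ] with p hp
  exact (tendsto_mixedCov hH1 a b hp.1 hp.2).comp (NNReal.tendsto_coe_atTop.2 tendsto_id)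

theorem aemeasurable_forwardAverage [IsProbabilityMeasure P]
    (hB : IsFractionalBrownianMotion H B P) (hH : 0 < H) (hθ : 0 < θ) (t : ℝ≥0) :
    AEMeasurable (forwardAverage θ B t) P := by
  simpa using (hB.hasLaw_average hH hθ t 1 0).aemeasurable

theorem aemeasurable_backwardAverage [IsProbabilityMeasure P]
    (hB : IsFractionalBrownianMotion H B P) (hH : 0 < H) (hθ : 0 < θ) (t : ℝ≥0) :
    AEMeasurable (backwardAverage θ B t) P := by
  simpa using (hB.hasLaw_average hH hθ t 0 1).aemeasurable

/-- The pair of averages converges in law to a pair of independent Gaussian variables. -/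
theorem tendstoInDistribution_averages [IsProbabilityMeasure P]
    (hB : IsFractionalBrownianMotion H B P) (hH : 0 < H) (hH1 : H < 1) (hθ : 0 < θ) :
    TendstoInDistribution
      (fun (t : ℝ≥0) ω => WithLp.toLp 2 (forwardAverage θ B t ω, backwardAverage θ B t ω)) atTop
      (fun p : ℝ × ℝ => WithLp.toLp 2 p) (fun _ => P)
      ((gaussianReal 0 (limitVariance θ H).toNNReal).prod
        (gaussianReal 0 (limitVariance θ H).toNNReal)) where
  forall_aemeasurable t := by
    have h1 := hB.aemeasurable_forwardAverage hH hθ t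
    have h2 := hB.aemeasurable_backwardAverage hH hθ t
    fun_prop
  tendsto := by
    have hm : ∀ t : ℝ≥0, AEMeasurable (fun ω =>
        WithLp.toLp 2 (forwardAverage θ B t ω, backwardAverage θ B t ω)) P := fun t => by
      have h1 := hB.aemeasurable_forwardAverage hH hθ t
      have h2 := hB.aemeasurable_backwardAverage hH hθ t
      fun_prop
    refine Filter.tendsto_of_seq_tendsto fun u hu =>
      ProbabilityMeasure.tendsto_of_tendsto_charFun fun ξ => ?_
    have hchar : ∀ t : ℝ≥0, charFun (P.map fun ω =>
        WithLp.toLp 2 (forwardAverage θ B t ω, backwardAverage θ B t ω)) ξ =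
        Complex.exp (-((((∫ p : ℝ × ℝ, mixedCov H t ξ.ofLp.1 ξ.ofLp.2 p.1 p.2
          ∂((expMeasure θ).prod (expMeasure θ))).toNNReal : ℝ) : ℂ) / 2)) := by
      intro t
      have hlaw := hB.hasLaw_average hH hθ t ξ.ofLp.1 ξ.ofLp.2
      -- The joint characteristic function at `ξ` is that of the scalar combination with
      -- coefficients `ξ`, evaluated at `1`.
      have h1 := charFun_gaussianReal (μ := 0) (v := (∫ p : ℝ × ℝ,
        mixedCov H t ξ.ofLp.1 ξ.ofLp.2 p.1 p.2 ∂((expMeasure θ).prod (expMeasure θ))).toNNReal) 1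
      rw [← hlaw.map_eq, charFun_apply, integral_map hlaw.aemeasurable (by fun_prop)] at h1
      rw [charFun_apply, integral_map (hm t) (by fun_prop)]
      simp only [WithLp.prod_inner_apply, RCLike.inner_apply, conj_trivial, one_mul,
        Complex.ofReal_one, Complex.ofReal_zero, mul_zero, zero_mul, one_pow, mul_one,
        zero_sub] at h1 ⊢
      exact h1
    have hv := limitVariance_pos hθ hH
    simp only [ProbabilityMeasure.coe_mk]
    rw [charFun_prod, charFun_gaussianReal, charFun_gaussianReal, ← Complex.exp_add,
      Real.coe_toNNReal _ hv.le]
    have hlim := ((hB.tendsto_integral_mixedCov hH hH1 hθ ξ.ofLp.1 ξ.ofLp.2).comp hu)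
    have hlim' := (Complex.continuous_ofReal.tendsto _).comp
      ((NNReal.continuous_coe.tendsto _).comp ((continuous_real_toNNReal.tendsto _).comp hlim))
    have := (Complex.continuous_exp.tendsto _).comp (hlim'.div_const 2).neg
    have hval : (ξ.ofLp.1 : ℂ) * (0 : ℝ) * Complex.I - limitVariance θ H * ξ.ofLp.1 ^ 2 / 2 +
        (ξ.ofLp.2 * (0 : ℝ) * Complex.I - limitVariance θ H * ξ.ofLp.2 ^ 2 / 2) =
        -((((((ξ.ofLp.1 ^ 2 + ξ.ofLp.2 ^ 2) * limitVariance θ H).toNNReal : ℝ)) : ℂ) / 2) := by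
      rw [Real.coe_toNNReal _ (by positivity)]
      push_cast
      ring
    rw [hval]
    exact this.congr fun n => (hchar (u n)).symm

theorem ae_samplePath_zero (hB : IsFractionalBrownianMotion H B P) :
    ∀ᵐ ω ∂P, samplePath B ω 0 = 0 := by
  filter_upwards [hB.start] with ω hω
  simpa [samplePath] using hω

theorem ae_continuous_backwardAverage (hB : IsFractionalBrownianMotion H B P) (hθ : 0 < θ)
    (t : ℝ≥0) :
    ∀ᵐ ω ∂P, (Continuous fun s : ℝ => samplePath (backwardAverage θ B) ω (max 0 (min s t)) ^ 2) ∧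
      ∃ C, ∀ s : ℝ, |samplePath (backwardAverage θ B) ω (max 0 (min s t)) ^ 2| ≤ C := by
  filter_upwards [hB.continuous_paths, hB.ae_samplePath_zero] with ω hω h0
  obtain ⟨A, hA, hAeq⟩ := exists_continuous_eq_backwardAverage hθ (continuous_samplePath hω) h0
  have h : ∀ s : ℝ, samplePath (backwardAverage θ B) ω (max 0 (min s t)) =
      A (max 0 (min s t)) := by
    intro s
    rw [samplePath, hAeq, Real.coe_toNNReal _ (le_max_left _ _)]
  simp_rw [h]
  exact ⟨by fun_prop, exists_bound_comp_clamp (f := fun s => A s ^ 2) (by fun_prop) (NNReal.coe_nonneg t)⟩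

theorem aemeasurable_errorRemainder [IsProbabilityMeasure P]
    (hB : IsFractionalBrownianMotion H B P) (hH : 0 < H) (hθ : 0 < θ) (t : ℝ≥0) :
    AEMeasurable (errorRemainder θ B t) P := by
  have h1 := hB.aemeasurable_backwardAverage hH hθ
  have h2 := aemeasurable_integral_of_continuous (P := P) (μ := volume.restrict (Set.Ioc (0 : ℝ) t))
    (Y := fun s ω => samplePath (backwardAverage θ B) ω (max 0 (min s t)) ^ 2)
    (fun s => (h1 _).pow_const 2) (hB.ae_continuous_backwardAverage hθ t)
  unfold errorRemainder
  simp_rw [integral_sq_eq_clamp]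
  exact ((((h1 t).pow_const 2).div_const 2).add (h2.const_mul θ)).const_mul _

theorem exists_lintegral_sq_backwardAverage_le [IsProbabilityMeasure P]
    (hB : IsFractionalBrownianMotion H B P) (hH : 0 < H) (hθ : 0 < θ) :
    ∃ c : ENNReal, c ≠ ⊤ ∧
      ∀ t, ∫⁻ ω, ENNReal.ofReal (backwardAverage θ B t ω ^ 2) ∂P ≤ c := by
  refine ⟨ENNReal.ofReal (∫ p : ℝ × ℝ, (|p.1| ^ (2 * H) + |p.2| ^ (2 * H))
      ∂((expMeasure θ).prod (expMeasure θ))) *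
      ∫⁻ x, ENNReal.ofReal (|x| ^ 2) ∂(gaussianReal 0 1),
    ENNReal.mul_ne_top ENNReal.ofReal_ne_top (lintegral_abs_pow_gaussianReal_lt_top 2).ne,
    fun t => ?_⟩
  have hlaw := hB.hasLaw_average hH hθ t 0 1
  simp only [zero_mul, one_mul, zero_add] at hlaw
  have h1 : ∫⁻ ω, ENNReal.ofReal (backwardAverage θ B t ω ^ 2) ∂P =
      ∫⁻ x, ENNReal.ofReal (|x| ^ 2) ∂(P.map (backwardAverage θ B t)) := by
    rw [lintegral_map' (by fun_prop) hlaw.aemeasurable]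
    simp only [sq_abs]
  rw [h1, hlaw.map_eq, lintegral_abs_pow_gaussianReal, Real.sq_sqrt (NNReal.coe_nonneg _)]
  gcongr
  rw [Real.coe_toNNReal']
  refine max_le ?_ (integral_nonneg fun p => by positivity)
  refine (le_abs_self _).trans (abs_integral_le_integral_abs.trans ?_)
  refine integral_mono_of_nonneg (ae_of_all _ fun p => abs_nonneg _)
    (integrable_fst_add_snd_expMeasure hθ hH) (ae_of_all _ fun p => ?_)
  simpa using hB.abs_mixedCov_le hH t 0 1 p.1 p.2

/-- If `c` bounds the second moments of the backward average, the `L¹` norm of the remainder is at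
most `e^{-θt} (1/2 + θt) c`. -/
theorem tendstoInMeasure_errorRemainder [IsProbabilityMeasure P]
    (hB : IsFractionalBrownianMotion H B P) (hH : 0 < H) (hθ : 0 < θ) :
    TendstoInMeasure P (errorRemainder θ B) atTop (fun _ => 0) := by
  obtain ⟨c, hc, hle⟩ := hB.exists_lintegral_sq_backwardAverage_le hH hθ
  refine tendstoInMeasure_of_tendsto_eLpNorm one_ne_zero
    (fun t => (hB.aemeasurable_errorRemainder hH hθ t).aestronglyMeasurable)
    aestronglyMeasurable_const ?_
  have hA := hB.aemeasurable_backwardAverage hH hθ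
  have hbound : ∀ t : ℝ≥0, eLpNorm (errorRemainder θ B t - (fun _ => 0 : Ω → ℝ)) 1 P ≤
      ENNReal.ofReal (Real.exp (-(θ * t)) * (1 / 2 + θ * t)) * c := by
    intro t
    have hint := lintegral_integral_le_of_continuous (P := P)
      (μ := volume.restrict (Set.Ioc (0 : ℝ) t))
      (Y := fun s ω => samplePath (backwardAverage θ B) ω (max 0 (min s t)) ^ 2)
      (fun s => (hA _).pow_const 2) (hB.ae_continuous_backwardAverage hθ t)
      (fun s ω => sq_nonneg _) (fun s => hle _)
    simp_rw [← integral_sq_eq_clamp] at hint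
    simp only [Measure.restrict_apply_univ, Real.volume_Ioc, sub_zero] at hint
    have hI0 : ∀ ω, 0 ≤ ∫ s in (0 : ℝ)..t, samplePath (backwardAverage θ B) ω s ^ 2 := fun ω =>
      intervalIntegral.integral_nonneg (NNReal.coe_nonneg t) fun s _ => sq_nonneg _
    have hR0 : ∀ ω, 0 ≤ errorRemainder θ B t ω := fun ω => by
      have := hI0 ω
      unfold errorRemainder
      positivity
    rw [eLpNorm_one_eq_lintegral_enorm]
    have hsplit : ∀ ω, ‖(errorRemainder θ B t - (fun _ => 0 : Ω → ℝ)) ω‖ₑ =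
        ENNReal.ofReal (Real.exp (-(θ * t)) * (1 / 2)) *
          ENNReal.ofReal (backwardAverage θ B t ω ^ 2) +
        ENNReal.ofReal (Real.exp (-(θ * t)) * θ) *
          ENNReal.ofReal (∫ s in (0 : ℝ)..t, samplePath (backwardAverage θ B) ω s ^ 2) := by
      intro ω
      rw [Pi.sub_apply, sub_zero, Real.enorm_of_nonneg (hR0 ω),
        ← ENNReal.ofReal_mul (by positivity), ← ENNReal.ofReal_mul (by positivity),
        ← ENNReal.ofReal_add (by positivity) (mul_nonneg (by positivity) (hI0 ω)), errorRemainder]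
      congr 1
      ring
    simp_rw [hsplit]
    have hm1 : AEMeasurable (fun ω => ENNReal.ofReal (backwardAverage θ B t ω ^ 2)) P :=
      ((hA t).pow_const 2).ennreal_ofReal
    rw [lintegral_add_left' (hm1.const_mul _), lintegral_const_mul' _ _ ENNReal.ofReal_ne_top,
      lintegral_const_mul' _ _ ENNReal.ofReal_ne_top, mul_add, ENNReal.ofReal_add (by positivity)
      (by positivity), add_mul]
    refine add_le_add (by gcongr; exact hle t) ?_
    calc _ ≤ ENNReal.ofReal (Real.exp (-(θ * t)) * θ) * (ENNReal.ofReal t * c) := by gcongr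
      _ = _ := by
        rw [← mul_assoc (ENNReal.ofReal _), ← ENNReal.ofReal_mul (by positivity),
          mul_assoc (Real.exp _)]
  have hlim : Tendsto (fun t : ℝ≥0 => Real.exp (-(θ * t)) * (1 / 2 + θ * t)) atTop (𝓝 0) := by
    have h1 : Tendsto (fun x : ℝ => Real.exp (-x) * (1 / 2 + x)) atTop (𝓝 0) := by
      have e0 := Real.tendsto_exp_neg_atTop_nhds_zero
      have e1 := Real.tendsto_pow_mul_exp_neg_atTop_nhds_zero 1
      have := (e0.mul_const (1 / 2)).add e1
      rw [zero_mul, add_zero] at this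
      refine this.congr fun x => ?_
      ring
    exact h1.comp ((NNReal.tendsto_coe_atTop.2 tendsto_id).const_mul_atTop hθ)
  have hlim2 := ENNReal.Tendsto.mul_const (ENNReal.tendsto_ofReal hlim) (b := c) (Or.inr hc)
  rw [ENNReal.ofReal_zero, zero_mul] at hlim2
  exact tendsto_of_tendsto_of_tendsto_of_le_of_le tendsto_const_nhds hlim2
    (fun _ => zero_le) hbound

end IsFractionalBrownianMotion

/-! ### Pathwise properties of `X`, and the limit of the estimation error. -/

theorem holderOnWith_of_abs_sub_le {f : ℝ → ℝ} {S : Set ℝ} {C α : ℝ} (hC : 0 ≤ C) (hα : 0 ≤ α)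
    (h : ∀ s ∈ S, ∀ t ∈ S, |f s - f t| ≤ C * |s - t| ^ α) :
    HolderOnWith C.toNNReal α.toNNReal f S := by
  intro s hs t ht
  rw [edist_dist, edist_dist, Real.dist_eq, Real.dist_eq, Real.coe_toNNReal _ hα,
    ENNReal.ofReal_rpow_of_nonneg (abs_nonneg _) hα, ENNReal.ofNNReal_toNNReal,
    ← ENNReal.ofReal_mul hC]
  exact ENNReal.ofReal_le_ofReal (h s hs t ht)

/-- Adding an absolutely continuous drift preserves Hölder continuity. -/
theorem exists_holder_add_integral {b x : ℝ → ℝ} {θ T α D : ℝ} (hT : 0 < T) (hα1 : α < 1)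
    (hD : 0 ≤ D) (hx : Continuous x)
    (hb : ∀ s ∈ Set.Icc (0 : ℝ) T, ∀ t ∈ Set.Icc (0 : ℝ) T, |b s - b t| ≤ D * |s - t| ^ α)
    (h : ∀ t, 0 ≤ t → x t = θ * (∫ s in (0 : ℝ)..t, x s) + b t) :
    ∃ C, 0 ≤ C ∧ ∀ s ∈ Set.Icc (0 : ℝ) T, ∀ t ∈ Set.Icc (0 : ℝ) T,
      |x s - x t| ≤ C * |s - t| ^ α := by
  obtain ⟨M, hM⟩ := isCompact_Icc.exists_bound_of_continuousOn (s := Set.Icc 0 T) hx.continuousOn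
  have hM0 : 0 ≤ M := (norm_nonneg _).trans (hM 0 ⟨le_rfl, hT.le⟩)
  refine ⟨|θ| * M * T ^ (1 - α) + D, by positivity, fun s hs t ht => ?_⟩
  have hint : |∫ r in t..s, x r| ≤ M * |s - t| := by
    refine intervalIntegral.norm_integral_le_of_norm_le_const fun r hr => hM r ?_
    exact (Set.uIcc_subset_Icc ht hs) (Set.uIoc_subset_uIcc hr)
  have hdiff : x s - x t = θ * (∫ r in t..s, x r) + (b s - b t) := by
    rw [h s hs.1, h t ht.1, ← intervalIntegral.integral_interval_sub_left
      (hx.intervalIntegrable 0 s) (hx.intervalIntegrable 0 t)]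
    ring
  have hpow : |s - t| ≤ T ^ (1 - α) * |s - t| ^ α := by
    rcases (abs_nonneg (s - t)).eq_or_lt with h0 | h0
    · rw [← h0]; positivity
    · calc |s - t| = |s - t| ^ (1 - α) * |s - t| ^ α := by
            rw [← Real.rpow_add h0, sub_add_cancel, Real.rpow_one]
        _ ≤ _ := by
            gcongr
            rw [abs_le]
            constructor <;> linarith [hs.1, hs.2, ht.1, ht.2]
  rw [hdiff]
  refine (abs_add_le _ _).trans ?_
  rw [abs_mul, add_mul]
  refine add_le_add ?_ (hb s hs t ht)
  calc |θ| * |∫ r in t..s, x r| ≤ |θ| * (M * (T ^ (1 - α) * |s - t| ^ α)) := by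
        gcongr
        exact hint.trans (by gcongr)
    _ = _ := by ring

theorem isYoungIntegral_self_of_abs_sub_le {f : ℝ → ℝ} {t α C : ℝ} (hC : 0 ≤ C)
    (hα : 1 / 2 < α) (hα1 : α < 1)
    (h : ∀ s ∈ Set.Icc (0 : ℝ) t, ∀ r ∈ Set.Icc (0 : ℝ) t, |f s - f r| ≤ C * |s - r| ^ α) :
    IsYoungIntegral f f 0 t ((f t ^ 2 - f 0 ^ 2) / 2) := by
  refine isYoungIntegral_self (α := α.toNNReal) ?_ ?_
    (holderOnWith_of_abs_sub_le hC (by linarith) h)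
  · rwa [Real.coe_toNNReal _ (by linarith)]
  · rwa [Real.toNNReal_lt_one]

namespace IsFractionalBrownianMotion
variable {Ω : Type*} [MeasurableSpace Ω] {P : Measure Ω} {θ H : ℝ} {B X : ℝ≥0 → Ω → ℝ}

theorem ae_holder_Icc (hB : IsFractionalBrownianMotion H B P) {α : ℝ} (hα : 0 < α)
    (hαH : α < H) : ∀ᵐ ω ∂P, ∀ T : ℕ, ∃ D, 0 ≤ D ∧ ∀ s ∈ Set.Icc (0 : ℝ) (T + 1),
      ∀ t ∈ Set.Icc (0 : ℝ) (T + 1), |samplePath B ω s - samplePath B ω t| ≤ D * |s - t| ^ α := by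
  rw [ae_all_iff]
  intro T
  filter_upwards [hB.ae_exists_holder hα hαH ((T : ℝ≥0) + 1)] with ω hω
  obtain ⟨D, hD, h⟩ := hω
  have hT : (0 : ℝ) < T + 1 := by positivity
  refine ⟨D * (((T : ℝ) + 1)⁻¹) ^ α, by positivity, fun s hs t ht => ?_⟩
  have hmem : ∀ s ∈ Set.Icc (0 : ℝ) (T + 1), s / (T + 1) ∈ Set.Icc (0 : ℝ) 1 := fun s hs =>
    ⟨div_nonneg hs.1 hT.le, (div_le_one hT).2 hs.2⟩
  have := h _ (hmem s hs) _ (hmem t ht)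
  push_cast at this
  rwa [mul_div_cancel₀ _ hT.ne', mul_div_cancel₀ _ hT.ne', ← sub_div, abs_div, abs_of_pos hT,
    div_eq_inv_mul, Real.mul_rpow (by positivity) (abs_nonneg _), ← mul_assoc] at this

/-- At each time `1/(n+1)` the path is a nondegenerate Gaussian variable, hence almost surely
nonzero. It rules out `X = 0` on `[0, t]`, where the equation would force `B = 0`. -/
theorem ae_exists_ne_zero (hB : IsFractionalBrownianMotion H B P) (hH : 0 < H) :
    ∀ᵐ ω ∂P, ∀ t : ℝ, 0 < t → ∃ s ∈ Set.Icc 0 t, samplePath B ω s ≠ 0 := by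
  have h : ∀ᵐ ω ∂P, ∀ n : ℕ, B ((n : ℝ≥0) + 1)⁻¹ ω - B 0 ω ≠ 0 := by
    rw [ae_all_iff]
    intro n
    have hlaw := hB.hasLaw_sub hH ((n : ℝ≥0) + 1)⁻¹ 0
    have hv : (|((((n : ℝ≥0) + 1)⁻¹ : ℝ≥0) : ℝ) - ((0 : ℝ≥0) : ℝ)| ^ (2 * H)).toNNReal ≠ 0 := by
      rw [ne_eq, Real.toNNReal_eq_zero, not_le]
      push_cast
      rw [sub_zero]
      positivity
    have := nullSingletonClass_gaussianReal (μ := 0) hv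
    have h0 := Measure.ae_ne (gaussianReal 0
      (|((((n : ℝ≥0) + 1)⁻¹ : ℝ≥0) : ℝ) - ((0 : ℝ≥0) : ℝ)| ^ (2 * H)).toNNReal) 0
    rw [← hlaw.map_eq] at h0
    exact ae_of_ae_map hlaw.aemeasurable h0
  filter_upwards [h, hB.start] with ω hω h0 t ht
  obtain ⟨n, hn⟩ := exists_nat_one_div_lt ht
  refine ⟨((n : ℝ) + 1)⁻¹, ⟨by positivity, by rw [← one_div]; exact hn.le⟩, ?_⟩
  have : (((n : ℝ) + 1)⁻¹).toNNReal = ((n : ℝ≥0) + 1)⁻¹ := by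
    rw [← Real.toNNReal_coe (r := ((n : ℝ≥0) + 1)⁻¹)]
    simp
  have h1 := hω n
  rw [h0, sub_zero] at h1
  rwa [samplePath, this]

theorem ae_isYoungIntegral_and_pos (hB : IsFractionalBrownianMotion H B P) (hH : 1 / 2 < H)
    (hH1 : H < 1) (hX : IsOrnsteinUhlenbeck θ B X P) :
    ∀ᵐ ω ∂P, ∀ t : ℝ≥0, 0 < t →
      IsYoungIntegral (samplePath X ω) (samplePath X ω) 0 t (samplePath X ω t ^ 2 / 2) ∧
        0 < ∫ s in (0 : ℝ)..t, samplePath X ω s ^ 2 := by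
  -- The Hölder order is the midpoint of `1/2` and `H`.
  filter_upwards [hB.ae_holder_Icc (α := (1 / 2 + H) / 2) (by linarith) (by linarith),
    hB.ae_exists_ne_zero (by linarith), hX] with ω hhol hne hx t ht
  obtain ⟨hxc, hx0, hxeq⟩ := hx
  have hc := continuous_samplePath hxc
  have heq : ∀ t, 0 ≤ t → samplePath X ω t =
      θ * (∫ s in (0 : ℝ)..t, samplePath X ω s) + samplePath B ω t := by
    intro t ht
    have := hxeq t.toNNReal
    rwa [Real.coe_toNNReal _ ht] at this
  have h0 : samplePath X ω 0 = 0 := by simpa [samplePath] using hx0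
  have htpos : (0 : ℝ) < t := NNReal.coe_pos.2 ht
  constructor
  · obtain ⟨T, hT⟩ := exists_nat_ge (t : ℝ)
    obtain ⟨D, hD, hb⟩ := hhol T
    obtain ⟨C, hC, h⟩ := exists_holder_add_integral (by positivity) (by linarith) hD hc hb heq
    have hsub : Set.Icc (0 : ℝ) t ⊆ Set.Icc 0 (T + 1) := Set.Icc_subset_Icc_right (by linarith)
    have := isYoungIntegral_self_of_abs_sub_le (t := t) hC (by linarith) (by linarith)
      fun s hs r hr => h s (hsub hs) r (hsub hr)
    rwa [h0, zero_pow two_ne_zero, sub_zero] at this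
  · refine intervalIntegral.integral_pos htpos (by fun_prop) (fun s _ => sq_nonneg _) ?_
    by_contra! hcon
    have hzero : ∀ s ∈ Set.Icc (0 : ℝ) t, samplePath X ω s = 0 := fun s hs =>
      pow_eq_zero_iff two_ne_zero |>.1 (le_antisymm (hcon s hs) (sq_nonneg _))
    obtain ⟨s, hs, hsne⟩ := hne t htpos
    have hint : ∫ r in (0 : ℝ)..s, samplePath X ω r = 0 := by
      rw [intervalIntegral.integral_congr (g := fun _ => (0 : ℝ))]
      · simp
      · intro r hr
        rw [Set.uIcc_of_le hs.1] at hr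
        exact hzero r ⟨hr.1, hr.2.trans hs.2⟩
    have := heq s hs.1
    rw [hzero s hs, hint, mul_zero, zero_add] at this
    exact hsne this.symm

/-- The estimation error, in terms of the averages of the driving path. -/
theorem ae_estimationError_eq (hB : IsFractionalBrownianMotion H B P) (hH : 1 / 2 < H)
    (hH1 : H < 1) (hθ : 0 < θ) (hX : IsOrnsteinUhlenbeck θ B X P) :
    ∀ᵐ ω ∂P, ∀ t : ℝ≥0, 0 < t →
      Real.exp (θ * t) * (leastSquaresEstimator X t ω - θ) =
        θ * (forwardAverage θ B t ω * backwardAverage θ B t ω - errorRemainder θ B t ω) /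
          (forwardAverage θ B t ω ^ 2 / 2 - Real.exp (-(θ * t)) *
            (forwardAverage θ B t ω * backwardAverage θ B t ω - errorRemainder θ B t ω)) := by
  filter_upwards [hB.ae_isYoungIntegral_and_pos hH hH1 hX, hB.ae_samplePath_zero,
    hB.continuous_paths, hX] with ω hyoung hb0 hbc hx t ht
  obtain ⟨hxc, -, hxeq⟩ := hx
  have hc := continuous_samplePath hxc
  have hb := continuous_samplePath hbc
  obtain ⟨hY, hS⟩ := hyoung t ht
  have heq : ∀ t, 0 ≤ t → samplePath X ω t =
      θ * (∫ s in (0 : ℝ)..t, samplePath X ω s) + samplePath B ω t := by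
    intro t ht
    have := hxeq t.toNNReal
    rwa [Real.coe_toNNReal _ ht] at this
  have hsol : ∀ t, 0 ≤ t → samplePath X ω t =
      samplePath B ω t + θ * linearODESolution θ (samplePath B ω) t := by
    intro t ht
    rw [heq t ht, integral_eq_linearODESolution hc hb heq ht, add_comm]
  have hA : ∀ t : ℝ≥0, backwardAverage θ B t ω =
      samplePath B ω t - θ * linearODESolution (-θ) (samplePath B ω) t := fun t =>
    integral_min_expMeasure_eq_backward hθ t.coe_nonneg hb hb0
  have hF : forwardAverage θ B t ω = Real.exp (-(θ * t)) * samplePath X ω t := by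
    rw [hsol t t.coe_nonneg]
    exact integral_min_expMeasure_eq_forward hθ t.coe_nonneg hb
  have hen := sq_linearODESolution_sub_integral θ hb t
  rw [← hsol t t.coe_nonneg, ← hA t] at hen
  have hint1 : ∫ s in (0 : ℝ)..t, (samplePath B ω s +
      θ * linearODESolution θ (samplePath B ω) s) ^ 2 = ∫ s in (0 : ℝ)..t, samplePath X ω s ^ 2 := by
    refine intervalIntegral.integral_congr fun s hs => ?_
    rw [Set.uIcc_of_le t.coe_nonneg] at hs
    simp only [hsol s hs.1]
  have hint2 : ∫ s in (0 : ℝ)..t, (samplePath B ω s -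
      θ * linearODESolution (-θ) (samplePath B ω) s) ^ 2 =
      ∫ s in (0 : ℝ)..t, samplePath (backwardAverage θ B) ω s ^ 2 := by
    refine intervalIntegral.integral_congr fun s hs => ?_
    rw [Set.uIcc_of_le t.coe_nonneg] at hs
    simp only [samplePath, hA, Real.coe_toNNReal _ hs.1]
  rw [hint1, hint2] at hen
  rw [leastSquaresEstimator, hY.youngIntegral_eq t.coe_nonneg, errorRemainder, hF]
  set S := ∫ s in (0 : ℝ)..t, samplePath X ω s ^ 2
  set Q := ∫ s in (0 : ℝ)..t, samplePath (backwardAverage θ B) ω s ^ 2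
  set x := samplePath X ω t
  set A := backwardAverage θ B t ω
  have hexp : Real.exp (θ * t) = (Real.exp (-(θ * t)))⁻¹ := by rw [Real.exp_neg, inv_inv]
  rw [hexp]
  have he : 0 < Real.exp (-(θ * t)) := Real.exp_pos _
  set e := Real.exp (-(θ * t))
  -- The energy identity rescaled by `e`. The next rewrite shows that the denominator is `e² θ S`,
  -- so the powers of `e` cancel in the quotient.
  have hnum : e * x * A - e * (A ^ 2 / 2 + θ * Q) = e * (x ^ 2 / 2 - θ * S) := by
    rw [hen]; ring
  rw [hnum, show (e * x) ^ 2 / 2 - e * (e * (x ^ 2 / 2 - θ * S)) = e ^ 2 * (θ * S) by ring]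
  field_simp

theorem map_two_mul_cauchyMeasure {v : ℝ≥0} (hv : v ≠ 0) (θ : ℝ) :
    (cauchyMeasure 0 1).map (fun x => 2 * θ * x) =
      ((gaussianReal 0 v).prod (gaussianReal 0 v)).map (fun p => 2 * θ * (p.2 / p.1)) := by
  rw [← map_div_prod_gaussianReal hv, Measure.map_map (by fun_prop) (by fun_prop)]
  rfl

/-- Convergence in law of the leading term of the estimation error. -/
theorem tendstoInDistribution_ratio [IsProbabilityMeasure P]
    (hB : IsFractionalBrownianMotion H B P) (hH : 0 < H) (hH1 : H < 1) (hθ : 0 < θ) :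
    TendstoInDistribution (fun (t : ℝ≥0) ω =>
        θ * (forwardAverage θ B t ω * backwardAverage θ B t ω - errorRemainder θ B t ω) /
          (forwardAverage θ B t ω ^ 2 / 2 - Real.exp (-(θ * t)) *
            (forwardAverage θ B t ω * backwardAverage θ B t ω - errorRemainder θ B t ω))) atTop
      (fun p : ℝ × ℝ => θ * (p.1 * p.2 - 0) / (p.1 ^ 2 / 2 - 0 * (p.1 * p.2 - 0))) (fun _ => P)
      ((gaussianReal 0 (limitVariance θ H).toNNReal).prod
        (gaussianReal 0 (limitVariance θ H).toNNReal)) := by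
  have hv : (limitVariance θ H).toNNReal ≠ 0 := by
    rw [ne_eq, Real.toNNReal_eq_zero, not_le]
    exact limitVariance_pos hθ hH
  have hexp : TendstoInMeasure P (fun (t : ℝ≥0) (_ : Ω) => Real.exp (-(θ * t))) atTop
      (fun _ => 0) := by
    intro ε hε
    have h1 : Tendsto (fun t : ℝ≥0 => Real.exp (-(θ * t))) atTop (𝓝 0) :=
      Real.tendsto_exp_neg_atTop_nhds_zero.comp
        ((NNReal.tendsto_coe_atTop.2 tendsto_id).const_mul_atTop hθ)
    refine tendsto_const_nhds.congr' ?_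
    filter_upwards [(tendsto_iff_edist_tendsto_0.1 h1).eventually (gt_mem_nhds hε)] with t ht
    have hempty : {x : Ω | ε ≤ edist (Real.exp (-(θ * t))) 0} = ∅ :=
      Set.eq_empty_of_forall_notMem fun x hx => not_lt.2 hx ht
    rw [hempty, measure_empty]
  have h3 := ((hB.tendstoInDistribution_averages hH hH1 hθ).prodMk_of_tendstoInMeasure_const _ _ _
    (hB.tendstoInMeasure_errorRemainder hH hθ)
    (hB.aemeasurable_errorRemainder hH hθ)).prodMk_of_tendstoInMeasure_const _ _ _ hexp
    (fun _ => aemeasurable_const)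
  -- At the limit the last two coordinates are `0`, so the denominator of `g` is `p.1² / 2`, nonzero
  -- almost surely since the Gaussian law has no atoms.
  refine h3.comp_of_ae_continuousAt
    (g := fun q : (WithLp 2 (ℝ × ℝ) × ℝ) × ℝ =>
      θ * (q.1.1.ofLp.1 * q.1.1.ofLp.2 - q.1.2) /
        (q.1.1.ofLp.1 ^ 2 / 2 - q.2 * (q.1.1.ofLp.1 * q.1.1.ofLp.2 - q.1.2))) ?_ ?_
  · fun_prop
  · have := nullSingletonClass_gaussianReal (μ := 0) hv
    have hne := Measure.quasiMeasurePreserving_fst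
      (μ := gaussianReal 0 (limitVariance θ H).toNNReal)
      (ν := gaussianReal 0 (limitVariance θ H).toNNReal) |>.ae
      (Measure.ae_ne (gaussianReal 0 (limitVariance θ H).toNNReal) (0 : ℝ))
    filter_upwards [hne] with p hp
    refine ContinuousAt.div (by fun_prop) (by fun_prop) ?_
    simpa using hp

end IsFractionalBrownianMotion

theorem theorem3p5 {Ω : Type*} [MeasurableSpace Ω] (P : Measure Ω) [IsProbabilityMeasure P]
    (H θ : ℝ) (hH : 1 / 2 < H) (hH1 : H < 1) (hθ : 0 < θ) (B X : ℝ≥0 → Ω → ℝ)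
    (hB : IsFractionalBrownianMotion H B P) (hX : IsOrnsteinUhlenbeck θ B X P) :
    (∀ᵐ ω ∂P, ∀ t : ℝ≥0, 0 < t →
      (∃ I, IsYoungIntegral (samplePath X ω) (samplePath X ω) 0 t I) ∧
        0 < ∫ s in (0 : ℝ)..t, samplePath X ω s ^ 2) ∧
    TendstoInDistribution
      (fun (t : ℝ≥0) (ω : Ω) => Real.exp (θ * t) * (leastSquaresEstimator X t ω - θ)) atTop
      (fun x : ℝ => 2 * θ * x) (fun _ => P) (cauchyMeasure 0 1) := by
  have hH0 : 0 < H := by linarith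
  refine ⟨?_, ?_⟩
  · filter_upwards [hB.ae_isYoungIntegral_and_pos hH hH1 hX] with ω hω t ht
    exact ⟨⟨_, (hω t ht).1⟩, (hω t ht).2⟩
  have hlim := hB.tendstoInDistribution_ratio hH0 hH1 hθ
  have hv : (limitVariance θ H).toNNReal ≠ 0 := by
    rw [ne_eq, Real.toNNReal_eq_zero, not_le]
    exact limitVariance_pos hθ hH0
  have herr := hB.ae_estimationError_eq hH hH1 hθ hX
  have hae : ∀ t : ℝ≥0, 0 < t → _ =ᵐ[P] _ := fun t ht => herr.mono fun ω hω => hω t ht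
  refine ⟨fun t => ?_, by fun_prop, ?_⟩
  -- At `t = 0` the estimator is `0` by the convention on division by zero, so the error is constant
  -- and measurable.
  · rcases eq_or_ne t 0 with rfl | ht
    · simp only [leastSquaresEstimator, NNReal.coe_zero, intervalIntegral.integral_same, div_zero]
      exact aemeasurable_const
    · exact (hlim.forall_aemeasurable t).congr (hae t (pos_iff_ne_zero.2 ht)).symm
  · have hlaw : (cauchyMeasure 0 1).map (fun x => 2 * θ * x) =
        ((gaussianReal 0 (limitVariance θ H).toNNReal).prod
          (gaussianReal 0 (limitVariance θ H).toNNReal)).map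
          (fun p : ℝ × ℝ => θ * (p.1 * p.2 - 0) / (p.1 ^ 2 / 2 - 0 * (p.1 * p.2 - 0))) := by
      rw [IsFractionalBrownianMotion.map_two_mul_cauchyMeasure hv]
      congr 1
      ext p
      -- On `p.1 = 0` both expressions are `0` by the division convention, so the two functions
      -- agree everywhere.
      rcases eq_or_ne p.1 0 with h | h
      · simp [h]
      · field_simp
        ring
    refine Eq.subst (motive := fun ν => Tendsto _ _ (𝓝 ν)) (Subtype.ext hlaw.symm)
      (hlim.tendsto.congr' ?_)
    filter_upwards [eventually_gt_atTop (0 : ℝ≥0)] with t ht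
    exact Subtype.ext (Measure.map_congr (hae t ht).symm)
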